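/- All manifolds are finite-dimensional, Hausdorff, second countable, connected, without boundary and of class $C^\infty$. For a manifold $M$ let $\mathcal E^1(M)=(TM\times\mathbb R)\oplus(T^*M\times\mathbb R)$, with the symmetric pairing $$\langle (X_1,f_1)+(\alpha_1,g_1),(X_2,f_2)+(\alpha_2,g_2)\rangle_+=\tfrac12\big(\alpha_1(X_2)+f_2g_1+\alpha_2(X_1)+f_1g_2\big)$$ and, on its smooth global sections, the bracket $$\begin{aligned}{}[(X_1,f_1)+(\alpha_1,g_1),&(X_2,f_2)+(\alpha_2,g_2)]=\big([X_1,X_2],\,X_1(f_2)-X_2(f_1)\big)\\ &+\Big(\mathcal L_{X_1}\alpha_2-\mathcal L_{X_2}\alpha_1+\tfrac12 d\big(\alpha_1(X_2)-\alpha_2(X_1)\big)+f_1\alpha_2-f_2\alpha_1\\ &\qquad+\tfrac12\big(g_2\,df_1-g_1\,df_2-f_1\,dg_2+f_2\,dg_1\big),\\ &\qquad X_1(g_2)-X_2(g_1)+\tfrac12\big(\alpha_1(X_2)-\alpha_2(X_1)-f_2g_1+f_1g_2\big)\Big).\end{aligned}$$ An $\mathcal E^1(M)$-Dirac structure is a smooth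 vector sub-bundle $L$ of $\mathcal E^1(M)$ whose fibres $L_x$ are maximally isotropic for $\langle\ ,\ \rangle_+$ and whose space of smooth global sections is closed under the bracket. Let $L$ be an $\mathcal E^1(M)$-Dirac structure and let $S$ be a submanifold of $M$, i.e. a manifold with an injective immersion into $M$. For $x\in S$ let $(T_xS)^\circ\subseteq T_x^*M$ be the annihilator of $T_xS$, and put $$(L_S)_x=\frac{L_x\cap\big((T_xS\times\mathbb R)\oplus(T_x^*M\times\mathbb R)\big)}{L_x\cap\big(\{0\}\oplus((T_xS)^\circ\times\{0\})\big)},$$ identified with a subspace of $(T_xS\times\mathbb R)\oplus(T_x^*S\times\mathbb R)$ through the injective linear map $[(u,\lambda)+(\alpha,\mu)]\mapsto(u,\lambda)+(\alpha|_{T_xS},\mu)$. Then the dimension of $L_x\cap((T_xS\times\mathbb R)\oplus(T_x^*M\times\mathbb R))$ is constant for $x\in S$ if and only if the dimension of $L_x\cap(\{0\}\oplus((T_xS)^\circ\times\{0\}))$ is constant for $x\in S$. If this is the case, then $L_S=\bigcup_{x\in S}(L_S)_x$ is a smooth vector sub-bundle of $\mathcal E^1(S)$, and $L_S$ is an $\mathcal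 E^1(S)$-Dirac structure. -/

import Mathlib

set_option maxSynthPendingDepth 3

open scoped Manifold ContDiff Topology

noncomputable section

namespace E1Dirac

/-! Throughout, `M` is a manifold without boundary modelled on `EuclideanSpace ℝ (Fin n)`. -/

/-- The fibre `(T_x M × ℝ) ⊕ (T_x^* M × ℝ)` of the vector bundle `𝓔¹(M)`.  An element
`(u, f) + (α, g)` is the nested pair `((u, f), (α, g))`. -/
abbrev Fib (n : ℕ) {M : Type*} [TopologicalSpace M] [ChartedSpace (EuclideanSpace ℝ (Fin n)) M]
    (x : M) : Type :=
  (TangentSpace (𝓡 n) x × ℝ) × ((TangentSpace (𝓡 n) x →L[ℝ] ℝ) × ℝ)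

section Basic

variable {n : ℕ} {M : Type*} [TopologicalSpace M] [ChartedSpace (EuclideanSpace ℝ (Fin n)) M]

/-- The symmetric pairing `<(u₁, f₁) + (α₁, g₁), (u₂, f₂) + (α₂, g₂)>₊` on a fibre of `𝓔¹(M)`. -/
def pairing {x : M} (a b : Fib n x) : ℝ :=
  (1 / 2) * (a.2.1 b.1.1 + b.1.2 * a.2.2 + b.2.1 a.1.1 + a.1.2 * b.2.2)

/-- A subspace of a fibre of `𝓔¹(M)` is isotropic if the symmetric pairing vanishes on it. -/
def IsIsotropic {x : M} (W : Submodule ℝ (Fib n x)) : Prop :=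
  ∀ a ∈ W, ∀ b ∈ W, pairing a b = 0

/-- Smoothness on `U` of a one-form, as a section of the cotangent bundle. -/
def SmoothFormOn [IsManifold (𝓡 n) ∞ M] (α : ∀ x : M, TangentSpace (𝓡 n) x →L[ℝ] ℝ)
    (U : Set M) : Prop :=
  ContMDiffOn (𝓡 n) ((𝓡 n).prod 𝓘(ℝ, EuclideanSpace ℝ (Fin n) →L[ℝ] ℝ)) ∞
    (fun x => Bundle.TotalSpace.mk' (EuclideanSpace ℝ (Fin n) →L[ℝ] ℝ)
      (E := fun x : M => TangentSpace (𝓡 n) x →L[ℝ] Bundle.Trivial M ℝ x) x (α x)) U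

/-- Smoothness on `U` of a vector field, as a section of the tangent bundle. -/
def SmoothFieldOn [IsManifold (𝓡 n) ∞ M] (X : ∀ x : M, TangentSpace (𝓡 n) x)
    (U : Set M) : Prop :=
  ContMDiffOn (𝓡 n) ((𝓡 n).prod 𝓘(ℝ, EuclideanSpace ℝ (Fin n))) ∞
    (fun x => Bundle.TotalSpace.mk' (EuclideanSpace ℝ (Fin n))
      (E := fun x : M => TangentSpace (𝓡 n) x) x (X x)) U

/-- Smoothness on `U` of a section `(X, f) + (α, g)` of `𝓔¹(M)`. -/
structure SmoothOn [IsManifold (𝓡 n) ∞ M] (e : ∀ x : M, Fib n x) (U : Set M) : Prop where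
  field : SmoothFieldOn (fun x => (e x).1.1) U
  fst : ContMDiffOn (𝓡 n) 𝓘(ℝ, ℝ) ∞ (fun x => (e x).1.2) U
  form : SmoothFormOn (fun x => (e x).2.1) U
  snd : ContMDiffOn (𝓡 n) 𝓘(ℝ, ℝ) ∞ (fun x => (e x).2.2) U

/-- `L` is a (smooth) vector sub-bundle of `𝓔¹(M)`: it has a constant rank `k` and near every
point it is spanned by a smooth local frame. -/
def IsSubbundle [IsManifold (𝓡 n) ∞ M] (L : ∀ x : M, Submodule ℝ (Fib n x)) : Prop :=
  ∃ k : ℕ, ∀ x₀ : M, ∃ U : Set M, IsOpen U ∧ x₀ ∈ U ∧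
    ∃ e : Fin k → ∀ x : M, Fib n x, (∀ i, SmoothOn (e i) U) ∧
      ∀ x ∈ U, LinearIndependent ℝ (fun i => e i x) ∧
        Submodule.span ℝ (Set.range fun i => e i x) = L x

/-- A one-form read in the preferred chart at `x₀`, that is, its pullback under the inverse of
that chart. -/
def chartForm (α : ∀ x : M, TangentSpace (𝓡 n) x →L[ℝ] ℝ) (x₀ : M) :
    EuclideanSpace ℝ (Fin n) → (EuclideanSpace ℝ (Fin n) →L[ℝ] ℝ) :=
  fun y => (α ((extChartAt (𝓡 n) x₀).symm y)).comp
    (mfderiv 𝓘(ℝ, EuclideanSpace ℝ (Fin n)) (𝓡 n) (extChartAt (𝓡 n) x₀).symm y)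

/-- The exterior derivative at `x` of a one-form `α`, computed in the preferred chart at `x`:
in a chart, `dα (u, v) = (D_u α) v - (D_v α) u`. -/
def dForm (α : ∀ x : M, TangentSpace (𝓡 n) x →L[ℝ] ℝ) (x : M) :
    TangentSpace (𝓡 n) x →L[ℝ] TangentSpace (𝓡 n) x →L[ℝ] ℝ :=
  let A : EuclideanSpace ℝ (Fin n) →L[ℝ] EuclideanSpace ℝ (Fin n) →L[ℝ] ℝ :=
    fderiv ℝ (chartForm α x) (extChartAt (𝓡 n) x x)
  let φ : EuclideanSpace ℝ (Fin n) →L[ℝ] EuclideanSpace ℝ (Fin n) :=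
    mfderiv (𝓡 n) 𝓘(ℝ, EuclideanSpace ℝ (Fin n)) (extChartAt (𝓡 n) x) x
  (A - A.flip).bilinearComp φ φ

/-- The Lie derivative of a one-form, `ℒ_X α = i_X dα + d (i_X α)`. -/
def lieForm (X : ∀ x : M, TangentSpace (𝓡 n) x) (α : ∀ x : M, TangentSpace (𝓡 n) x →L[ℝ] ℝ)
    (x : M) : TangentSpace (𝓡 n) x →L[ℝ] ℝ :=
  dForm α x (X x) + mvfderiv (𝓡 n) (fun y => α y (X y)) x

/-- The bracket of two sections of `𝓔¹(M)`, with `e₁ = (X₁, f₁) + (α₁, g₁)` and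
`e₂ = (X₂, f₂) + (α₂, g₂)`.  Here `mvfderiv (𝓡 n) f x` is the differential `df` at `x`. -/
def bracket (e₁ e₂ : ∀ x : M, Fib n x) (x : M) : Fib n x :=
  let X₁ : ∀ y : M, TangentSpace (𝓡 n) y := fun y => (e₁ y).1.1
  let X₂ : ∀ y : M, TangentSpace (𝓡 n) y := fun y => (e₂ y).1.1
  let f₁ : M → ℝ := fun y => (e₁ y).1.2
  let f₂ : M → ℝ := fun y => (e₂ y).1.2
  let α₁ : ∀ y : M, TangentSpace (𝓡 n) y →L[ℝ] ℝ := fun y => (e₁ y).2.1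
  let α₂ : ∀ y : M, TangentSpace (𝓡 n) y →L[ℝ] ℝ := fun y => (e₂ y).2.1
  let g₁ : M → ℝ := fun y => (e₁ y).2.2
  let g₂ : M → ℝ := fun y => (e₂ y).2.2
  ((VectorField.mlieBracket (𝓡 n) X₁ X₂ x,
    mvfderiv (𝓡 n) f₂ x (X₁ x) - mvfderiv (𝓡 n) f₁ x (X₂ x)),
   (lieForm X₁ α₂ x - lieForm X₂ α₁ x
      + (1 / 2 : ℝ) • mvfderiv (𝓡 n) (fun y => α₁ y (X₂ y) - α₂ y (X₁ y)) x
      + f₁ x • α₂ x - f₂ x • α₁ x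
      + (1 / 2 : ℝ) • (g₂ x • mvfderiv (𝓡 n) f₁ x - g₁ x • mvfderiv (𝓡 n) f₂ x
          - f₁ x • mvfderiv (𝓡 n) g₂ x + f₂ x • mvfderiv (𝓡 n) g₁ x),
    mvfderiv (𝓡 n) g₂ x (X₁ x) - mvfderiv (𝓡 n) g₁ x (X₂ x)
      + (1 / 2) * (α₁ x (X₂ x) - α₂ x (X₁ x) - f₂ x * g₁ x + f₁ x * g₂ x)))

/-- An `𝓔¹(M)`-Dirac structure: a vector sub-bundle of `𝓔¹(M)`, each fibre of which is maximal
among the isotropic subspaces, and whose smooth global sections are closed under the bracket.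
(The bracket of smooth sections of `𝓔¹(M)` is always a smooth section of `𝓔¹(M)`.) -/
structure IsDirac [IsManifold (𝓡 n) ∞ M] (L : ∀ x : M, Submodule ℝ (Fib n x)) : Prop where
  isSubbundle : IsSubbundle L
  maximal_isotropic : ∀ x, Maximal IsIsotropic (L x)
  bracket_mem : ∀ e₁ e₂ : ∀ x : M, Fib n x,
    SmoothOn e₁ Set.univ → (∀ x, e₁ x ∈ L x) →
    SmoothOn e₂ Set.univ → (∀ x, e₂ x ∈ L x) → ∀ x, bracket e₁ e₂ x ∈ L x

end Basic

/-! A submanifold `S` of `M` is given by an injective immersion `j : S → M`; the tangent space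
`T_x S` is viewed in `T_{j x} M` through the differential `D` of `j` at `x`. -/

section Submanifold

variable {n s : ℕ}
  {M : Type*} [TopologicalSpace M] [ChartedSpace (EuclideanSpace ℝ (Fin n)) M]
  {S : Type*} [TopologicalSpace S] [ChartedSpace (EuclideanSpace ℝ (Fin s)) S]
  {x : S} {y : M}

/-- The space `W ∩ ((T_x S × ℝ) ⊕ (T_y^* M × ℝ))`, for a subspace `W` of the fibre at `y`. -/
def hat (W : Submodule ℝ (Fib n y)) (D : TangentSpace (𝓡 s) x →L[ℝ] TangentSpace (𝓡 n) y) :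
    Submodule ℝ (Fib n y) :=
  W ⊓ ((LinearMap.range D.toLinearMap).prod ⊤).prod ⊤

/-- The annihilator `(T_x S)° ⊆ T_y^* M`. -/
def annihilator (D : TangentSpace (𝓡 s) x →L[ℝ] TangentSpace (𝓡 n) y) :
    Submodule ℝ (TangentSpace (𝓡 n) y →L[ℝ] ℝ) where
  carrier := {α | ∀ u : TangentSpace (𝓡 s) x, α (D u) = 0}
  add_mem' := by
    intro a b ha hb u
    have h1 : a (D u) = 0 := ha u
    have h2 : b (D u) = 0 := hb u
    simp [h1, h2]
  zero_mem' := by intro u; simp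
  smul_mem' := by
    intro c a ha u
    have h1 : a (D u) = 0 := ha u
    simp [h1]

/-- The space `W ∩ ({0} ⊕ ((T_x S)° × {0}))`. -/
def conormal (W : Submodule ℝ (Fib n y)) (D : TangentSpace (𝓡 s) x →L[ℝ] TangentSpace (𝓡 n) y) :
    Submodule ℝ (Fib n y) :=
  W ⊓ (⊥ : Submodule ℝ (TangentSpace (𝓡 n) y × ℝ)).prod ((annihilator D).prod ⊥)

/-- The quotient `(W ∩ ((T_x S × ℝ) ⊕ (T_y^* M × ℝ))) / (W ∩ ({0} ⊕ ((T_x S)° × {0})))`. -/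
abbrev PointQuotient (W : Submodule ℝ (Fib n y))
    (D : TangentSpace (𝓡 s) x →L[ℝ] TangentSpace (𝓡 n) y) : Type :=
  hat W D ⧸ (conormal W D).submoduleOf (hat W D)

/-- The linear map `(u, f) + (α, g) ↦ (u, f) + (α|_{T_x S}, g)` from
`W ∩ ((T_x S × ℝ) ⊕ (T_y^* M × ℝ))` to the fibre of `𝓔¹(S)` at `x`, where a vector of
`T_y M` in the image of the injective map `D` is identified with its preimage in `T_x S`. -/
def restrict (W : Submodule ℝ (Fib n y)) (D : TangentSpace (𝓡 s) x →L[ℝ] TangentSpace (𝓡 n) y)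
    (h : Function.Injective D) : hat W D →ₗ[ℝ] Fib s x where
  toFun a := (((LinearEquiv.ofInjective D.toLinearMap h).symm ⟨a.1.1.1, a.2.2.1.1⟩,
    a.1.1.2), (a.1.2.1.comp D, a.1.2.2))
  map_add' a b := by
    have := (LinearEquiv.ofInjective D.toLinearMap h).symm.map_add
      ⟨a.1.1.1, a.2.2.1.1⟩ ⟨b.1.1.1, b.2.2.1.1⟩
    exact Prod.ext (Prod.ext this rfl) (Prod.ext (ContinuousLinearMap.ext fun u => rfl) rfl)
  map_smul' c a := by
    have := (LinearEquiv.ofInjective D.toLinearMap h).symm.map_smul c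
      ⟨a.1.1.1, a.2.2.1.1⟩
    exact Prod.ext (Prod.ext this rfl) (Prod.ext (ContinuousLinearMap.ext fun u => rfl) rfl)

theorem restrict_eq_iff (W : Submodule ℝ (Fib n y))
    (D : TangentSpace (𝓡 s) x →L[ℝ] TangentSpace (𝓡 n) y) (h : Function.Injective D)
    (a : hat W D) (p : Fib s x) :
    restrict W D h a = p ↔
      a.1.1.1 = D p.1.1 ∧ a.1.1.2 = p.1.2 ∧ a.1.2.1.comp D = p.2.1 ∧ a.1.2.2 = p.2.2 := by
  have key : (LinearEquiv.ofInjective D.toLinearMap h).symm ⟨a.1.1.1, a.2.2.1.1⟩ = p.1.1 ↔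
      a.1.1.1 = D p.1.1 := by
    rw [LinearEquiv.symm_apply_eq, Subtype.ext_iff]
    rfl
  rw [← key, Prod.ext_iff, Prod.ext_iff, Prod.ext_iff, and_assoc]
  rfl

theorem ker_restrict (W : Submodule ℝ (Fib n y))
    (D : TangentSpace (𝓡 s) x →L[ℝ] TangentSpace (𝓡 n) y) (h : Function.Injective D) :
    LinearMap.ker (restrict W D h) = (conormal W D).submoduleOf (hat W D) := by
  ext a
  rw [LinearMap.mem_ker, restrict_eq_iff]
  constructor
  · rintro ⟨h1, h2, h3, h4⟩
    refine ⟨a.2.1, Prod.ext (h1.trans (map_zero D)) h2, ?_, h4⟩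
    intro u
    exact congrArg (fun β : TangentSpace (𝓡 s) x →L[ℝ] ℝ => β u) h3
  · rintro ⟨-, h1, h2, h3⟩
    refine ⟨(congrArg Prod.fst h1).trans (map_zero D).symm, congrArg Prod.snd h1, ?_, h3⟩
    exact ContinuousLinearMap.ext fun u => h2 u

/-- The induced map `[(u, f) + (α, g)] ↦ (u, f) + (α|_{T_x S}, g)` on the quotient. -/
def quotientMap (W : Submodule ℝ (Fib n y))
    (D : TangentSpace (𝓡 s) x →L[ℝ] TangentSpace (𝓡 n) y) (h : Function.Injective D) :
    PointQuotient W D →ₗ[ℝ] Fib s x :=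
  Submodule.liftQ _ (restrict W D h) (ker_restrict W D h).ge

/-- The induced map is a monomorphism. -/
theorem quotientMap_injective (W : Submodule ℝ (Fib n y))
    (D : TangentSpace (𝓡 s) x →L[ℝ] TangentSpace (𝓡 n) y) (h : Function.Injective D) :
    Function.Injective (quotientMap W D h) := by
  rw [← LinearMap.ker_eq_bot]
  exact Submodule.ker_liftQ_eq_bot _ _ _ (ker_restrict W D h).le

/-- The differential of an immersion is injective. -/
theorem mfderiv_injective_of_isImmersion [IsManifold (𝓡 n) ∞ M] [IsManifold (𝓡 s) ∞ S]
    {j : S → M} (hj : Manifold.IsImmersion (𝓡 s) (𝓡 n) ∞ j) (x : S) :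
    Function.Injective (mfderiv (𝓡 s) (𝓡 n) j x) := by
  obtain ⟨F, _, _, hF⟩ := hj.isImmersionAt x
  have hφ := hF.domChart.contMDiffAt_extend hF.domChart_mem_maximalAtlas hF.mem_domChart_source
  have hψ := hF.codChart.contMDiffAt_extend hF.codChart_mem_maximalAtlas hF.mem_codChart_source
  have hφd := hφ.mdifferentiableAt (by simp)
  have hψd := hψ.mdifferentiableAt (by simp)
  have hjd : MDifferentiableAt (𝓡 s) (𝓡 n) j x := hj.contMDiff.mdifferentiableAt (by simp)
  let T : EuclideanSpace ℝ (Fin s) →L[ℝ] EuclideanSpace ℝ (Fin n) :=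
    hF.equiv.toContinuousLinearMap.comp (ContinuousLinearMap.inl ℝ (EuclideanSpace ℝ (Fin s)) F)
  have hT : Function.Injective T := fun a b hab => by
    have := hF.equiv.injective hab
    simpa using this
  have heq : hF.codChart.extend (𝓡 n) ∘ j =ᶠ[𝓝 x] T ∘ hF.domChart.extend (𝓡 s) := by
    filter_upwards [hF.domChart.open_source.mem_nhds hF.mem_domChart_source] with z hz
    have hz' : z ∈ (hF.domChart.extend (𝓡 s)).source := by
      rwa [OpenPartialHomeomorph.extend_source]
    have h := hF.writtenInCharts ((hF.domChart.extend (𝓡 s)).map_source hz')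
    simp only [Function.comp_apply] at h
    rw [(hF.domChart.extend (𝓡 s)).left_inv hz'] at h
    exact h
  have hTd : MDifferentiableAt 𝓘(ℝ, EuclideanSpace ℝ (Fin s)) 𝓘(ℝ, EuclideanSpace ℝ (Fin n)) T
      (hF.domChart.extend (𝓡 s) x) := T.differentiableAt.mdifferentiableAt
  have h1 := heq.mfderiv_eq (I := 𝓡 s) (I' := 𝓘(ℝ, EuclideanSpace ℝ (Fin n)))
  rw [mfderiv_comp x hψd hjd, mfderiv_comp x hTd hφd] at h1
  have hφi : Function.Injective
      (mfderiv (𝓡 s) 𝓘(ℝ, EuclideanSpace ℝ (Fin s)) (hF.domChart.extend (𝓡 s)) x) := by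
    have hsymm : MDifferentiableAt 𝓘(ℝ, EuclideanSpace ℝ (Fin s)) (𝓡 s)
        (hF.domChart.extend (𝓡 s)).symm (hF.domChart.extend (𝓡 s) x) := by
      refine ((contMDiffOn_extend_symm hF.domChart_mem_maximalAtlas).contMDiffAt
        ?_).mdifferentiableAt (by simp)
      have := hF.domChart.open_target.mem_nhds
        (hF.domChart.map_source hF.mem_domChart_source)
      simpa using this
    have hid : (hF.domChart.extend (𝓡 s)).symm ∘ hF.domChart.extend (𝓡 s) =ᶠ[𝓝 x] id := by
      filter_upwards [hF.domChart.open_source.mem_nhds hF.mem_domChart_source] with z hz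
      exact (hF.domChart.extend (𝓡 s)).left_inv (by rwa [OpenPartialHomeomorph.extend_source])
    have h2 := hid.mfderiv_eq (I := 𝓡 s) (I' := 𝓡 s)
    rw [mfderiv_comp x hsymm hφd, mfderiv_id] at h2
    intro a b hab
    have ha := DFunLike.congr_fun h2 a
    have hb := DFunLike.congr_fun h2 b
    simp only [ContinuousLinearMap.comp_apply, hab] at ha hb
    exact ha.symm.trans hb
  have hTm : mfderiv 𝓘(ℝ, EuclideanSpace ℝ (Fin s)) 𝓘(ℝ, EuclideanSpace ℝ (Fin n)) T
      (hF.domChart.extend (𝓡 s) x) = T := by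
    rw [mfderiv_eq_fderiv]
    exact T.fderiv
  intro a b hab
  have ha := DFunLike.congr_fun h1 a
  have hb := DFunLike.congr_fun h1 b
  simp only [ContinuousLinearMap.comp_apply, hab] at ha hb
  have h3 := ha.symm.trans hb
  rw [hTm] at h3
  exact hφi (hT h3)

/-- `(L_S)_x`: the quotient
`(L_x ∩ ((T_x S × ℝ) ⊕ (T_x^* M × ℝ))) / (L_x ∩ ({0} ⊕ ((T_x S)° × {0})))`, identified with a
subspace of `(T_x S × ℝ) ⊕ (T_x^* S × ℝ)` by means of the induced monomorphism. -/
def induced [IsManifold (𝓡 n) ∞ M] [IsManifold (𝓡 s) ∞ S]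
    (L : ∀ y : M, Submodule ℝ (Fib n y)) {j : S → M}
    (hj : Manifold.IsImmersion (𝓡 s) (𝓡 n) ∞ j) (x : S) : Submodule ℝ (Fib s x) :=
  LinearMap.range (quotientMap (L (j x)) (mfderiv (𝓡 s) (𝓡 n) j x)
    (mfderiv_injective_of_isImmersion hj x))

theorem mem_induced [IsManifold (𝓡 n) ∞ M] [IsManifold (𝓡 s) ∞ S]
    (L : ∀ y : M, Submodule ℝ (Fib n y)) {j : S → M}
    (hj : Manifold.IsImmersion (𝓡 s) (𝓡 n) ∞ j) (x : S) (p : Fib s x) :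
    p ∈ induced L hj x ↔ ∃ α : TangentSpace (𝓡 n) (j x) →L[ℝ] ℝ,
      α.comp (mfderiv (𝓡 s) (𝓡 n) j x) = p.2.1 ∧
        ((mfderiv (𝓡 s) (𝓡 n) j x p.1.1, p.1.2), (α, p.2.2)) ∈ L (j x) := by
  rw [induced, quotientMap, Submodule.range_liftQ, LinearMap.mem_range]
  constructor
  · rintro ⟨a, ha⟩
    obtain ⟨h1, h2, h3, h4⟩ := (restrict_eq_iff _ _ _ _ _).1 ha
    refine ⟨a.1.2.1, h3, ?_⟩
    rw [← h1, ← h2, ← h4]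
    exact a.2.1
  · rintro ⟨α, hα, hL⟩
    exact ⟨⟨_, hL, ⟨⟨p.1.1, rfl⟩, trivial⟩, trivial⟩,
      (restrict_eq_iff _ _ _ _ _).2 ⟨rfl, rfl, hα, rfl⟩⟩

end Submanifold

end E1Dirac

end

/-! Pointwise, everything follows from linear algebra. The pairing on a fibre of `𝓔¹(M)` is
nondegenerate of split signature `(n + 1, n + 1)`, so a maximal isotropic subspace equals its own
orthogonal and has dimension `n + 1` (`isLagrangian_of_maximal`). Restriction to `S` preserves the
pairing, and a double-orthogonal argument shows that it carries Lagrangian subspaces to Lagrangian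
subspaces (`IsLagrangian.range_restrict`). Thus each `(L_S)_x` has dimension `s + 1`, and
rank–nullity for the restriction map gives `dim hat = s + 1 + dim conormal`, whence the equivalence
of the two constancy conditions.

For smoothness, the relation `Rel` between elements over `M` and over `S` becomes, in charts and in
a local frame of `L`, a smooth linear equation in the frame coefficients (`exists_chart_equation`).
The solution spaces of the two homogeneous equations involved are `conormal` and `hat`, so constant
rank allows solutions to be chosen smoothly (`exists_smooth_solution`). The `hat` equation yields
smooth local sections of `L_S` through any prescribed vector, hence local frames; the `conormal`
equation yields smooth lifts of sections of `L_S` to `L` along `S`.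

For closure under the bracket, such a lift is carried from `S` to an open set of `M` by a local
retraction and then cut off by a bump function, giving a global section of `L` related to the given
one near a point. The bracket preserves relatedness (`rel_bracket`), because the second derivatives
of the immersion that appear cancel by symmetry. The bracket of the extensions lies in `L`, so the
bracket on `S` lies in `L_S`. -/

noncomputable section

namespace E1Dirac

/-! ### Lagrangian subspaces of a fibre and their restriction to a submanifold -/

section LinearAlgebra

open Module

variable {n s : ℕ}
  {M : Type*} [TopologicalSpace M] [ChartedSpace (EuclideanSpace ℝ (Fin n)) M]
  {S : Type*} [TopologicalSpace S] [ChartedSpace (EuclideanSpace ℝ (Fin s)) S]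
  {x : S} {y : M}

instance finiteDimensional_tangentSpace : FiniteDimensional ℝ (TangentSpace (𝓡 n) y) :=
  inferInstanceAs (FiniteDimensional ℝ (EuclideanSpace ℝ (Fin n)))

instance finiteDimensional_cotangentSpace :
    FiniteDimensional ℝ (TangentSpace (𝓡 n) y →L[ℝ] ℝ) :=
  inferInstanceAs (FiniteDimensional ℝ (EuclideanSpace ℝ (Fin n) →L[ℝ] ℝ))

theorem finrank_fib : finrank ℝ (Fib n y) = 2 * (n + 1) := by
  have h1 : finrank ℝ (TangentSpace (𝓡 n) y) = n :=
    finrank_euclideanSpace_fin (𝕜 := ℝ) (n := n)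
  have h2 : finrank ℝ (TangentSpace (𝓡 n) y →L[ℝ] ℝ) = n := by
    have e : (TangentSpace (𝓡 n) y →ₗ[ℝ] ℝ) ≃ₗ[ℝ] (TangentSpace (𝓡 n) y →L[ℝ] ℝ) :=
      (LinearMap.toContinuousLinearMap (E := EuclideanSpace ℝ (Fin n)) (F' := ℝ) (𝕜 := ℝ))
    rw [← e.finrank_eq, Module.finrank_linearMap, h1]
    simp
  rw [finrank_prod, finrank_prod, finrank_prod, h1, h2]
  simp
  ring

/-- The symmetric pairing as a bilinear form on a fibre of `𝓔¹(M)`. -/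
def pairingForm (y : M) : LinearMap.BilinForm ℝ (Fib n y) :=
  LinearMap.mk₂ ℝ pairing
    (fun a b c => by
      simp only [pairing, Prod.fst_add, Prod.snd_add, map_add, add_apply]
      ring)
    (fun t a b => by
      simp only [pairing, Prod.smul_fst, Prod.smul_snd, map_smul, smul_apply, smul_eq_mul]
      ring)
    (fun a b c => by
      simp only [pairing, Prod.fst_add, Prod.snd_add, map_add, add_apply]
      ring)
    (fun t a b => by
      simp only [pairing, Prod.smul_fst, Prod.smul_snd, map_smul, smul_apply, smul_eq_mul]
      ring)

@[simp]
theorem pairingForm_apply (a b : Fib n y) : pairingForm y a b = pairing a b := rfl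

theorem pairing_comm (a b : Fib n y) : pairing a b = pairing b a := by
  unfold pairing; ring

theorem isRefl_pairingForm : (pairingForm (n := n) y).IsRefl := fun a b h =>
  (pairing_comm (n := n) b a).trans h

theorem exists_form_vanishing (V : Submodule ℝ (TangentSpace (𝓡 n) y))
    {u : TangentSpace (𝓡 n) y} (hu : u ∉ V) :
    ∃ β : TangentSpace (𝓡 n) y →L[ℝ] ℝ, β u ≠ 0 ∧ ∀ v ∈ V, β v = 0 := by
  obtain ⟨f, hf, hV⟩ := Submodule.exists_le_ker_of_notMem hu
  exact ⟨(LinearMap.toContinuousLinearMap (E := EuclideanSpace ℝ (Fin n)) (F' := ℝ) (𝕜 := ℝ) f :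
    EuclideanSpace ℝ (Fin n) →L[ℝ] ℝ), hf, fun v hv => hV hv⟩

theorem eq_zero_of_pairing_eq_zero {a : Fib n y} (h : ∀ b, pairing a b = 0) : a = 0 := by
  have h1 : a.2.1 = 0 := by
    ext v
    have := h ((v, 0), (0, 0))
    simpa [pairing] using this
  have h2 : a.1.2 = 0 := by
    have := h ((0, 0), (0, 1))
    simpa [pairing] using this
  have h3 : a.2.2 = 0 := by
    have := h ((0, 1), (0, 0))
    simpa [pairing] using this
  have h4 : a.1.1 = 0 := by
    by_contra hne
    obtain ⟨β, hβ, -⟩ := exists_form_vanishing (⊥ : Submodule ℝ (TangentSpace (𝓡 n) y))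
      (u := a.1.1) (by simpa using hne)
    have := h ((0, 0), (β, 0))
    exact hβ (by simpa [pairing] using this)
  exact Prod.ext (Prod.ext h4 h2) (Prod.ext h1 h3)

theorem nondegenerate_pairingForm : (pairingForm (n := n) y).Nondegenerate :=
  ⟨fun _ h => eq_zero_of_pairing_eq_zero h,
    fun a h => eq_zero_of_pairing_eq_zero fun b => (pairing_comm (n := n) a b).trans (h b)⟩

/-- A subspace of a fibre of `𝓔¹(M)` is Lagrangian if it is its own orthogonal complement. -/
def IsLagrangian (W : Submodule ℝ (Fib n y)) : Prop :=
  (pairingForm y).orthogonal W = W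

theorem IsLagrangian.mem_iff {W : Submodule ℝ (Fib n y)} (hW : IsLagrangian W) (a : Fib n y) :
    a ∈ W ↔ ∀ b ∈ W, pairing b a = 0 := by
  conv_lhs => rw [← hW]
  rfl

theorem isLagrangian_iff {W : Submodule ℝ (Fib n y)} :
    IsLagrangian W ↔ ∀ a, a ∈ W ↔ ∀ b ∈ W, pairing b a = 0 :=
  ⟨fun h => h.mem_iff, fun h => Submodule.ext fun a => (h a).symm⟩

theorem IsLagrangian.finrank_eq {W : Submodule ℝ (Fib n y)} (hW : IsLagrangian W) :
    finrank ℝ W = n + 1 := by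
  have h := LinearMap.BilinForm.finrank_orthogonal (nondegenerate_pairingForm (n := n) (y := y)) W
  have h2 := W.finrank_le
  rw [hW, finrank_fib] at h
  rw [finrank_fib] at h2
  omega

theorem IsLagrangian.maximal {W : Submodule ℝ (Fib n y)} (hW : IsLagrangian W) :
    Maximal IsIsotropic W := by
  refine ⟨fun a ha b hb => (hW.mem_iff b).1 hb a ha, fun V hV hWV a ha => ?_⟩
  exact (hW.mem_iff a).2 fun b hb => hV b (hWV hb) a ha

/-- The graph of `c` times the flat metric, a subspace on which the pairing is definite. -/
def definiteGraph (y : M) (c : ℝ) :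
    (EuclideanSpace ℝ (Fin n) × ℝ) →ₗ[ℝ] Fib n y where
  toFun p := ((p.1, p.2), ((c • innerSL ℝ p.1 : EuclideanSpace ℝ (Fin n) →L[ℝ] ℝ), c * p.2))
  map_add' p q := by
    refine Prod.ext rfl (Prod.ext ?_ (mul_add _ _ _))
    exact (congrArg (c • ·) (map_add (innerSL ℝ) p.1 q.1)).trans (smul_add _ _ _)
  map_smul' t p := by
    refine Prod.ext rfl (Prod.ext ?_ (mul_left_comm _ _ _))
    exact (congrArg (c • ·) (map_smul (innerSL ℝ) t p.1)).trans (smul_comm c t (innerSL ℝ p.1))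

theorem pairing_definiteGraph (c : ℝ) (p : EuclideanSpace ℝ (Fin n) × ℝ) :
    pairing (definiteGraph (n := n) y c p) (definiteGraph y c p) = c * (‖p.1‖ ^ 2 + p.2 ^ 2) := by
  have h : (c • innerSL ℝ p.1 : EuclideanSpace ℝ (Fin n) →L[ℝ] ℝ) p.1 = c * ‖p.1‖ ^ 2 := by
    simp
  change 1 / 2 * ((c • innerSL ℝ p.1 : EuclideanSpace ℝ (Fin n) →L[ℝ] ℝ) p.1 + p.2 * (c * p.2)
    + (c • innerSL ℝ p.1 : EuclideanSpace ℝ (Fin n) →L[ℝ] ℝ) p.1 + p.2 * (c * p.2)) = _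
  rw [h]; ring

/-- The graph has dimension `n + 1` in a space of dimension `2 (n + 1)`, so a larger subspace must
meet it. Used with `c = 1` and `c = -1`, it produces vectors of both signs. -/
theorem exists_mem_definiteGraph (V : Submodule ℝ (Fib n y)) (hV : n + 1 < finrank ℝ V) (c : ℝ) :
    ∃ a ∈ V, ∃ r : ℝ, 0 < r ∧ pairing a a = c * r := by
  have hinj : Function.Injective (definiteGraph (n := n) y c) := fun p q h => congrArg Prod.fst h
  have hr := LinearMap.finrank_range_of_inj hinj
  have hd : finrank ℝ (EuclideanSpace ℝ (Fin n) × ℝ) = n + 1 := by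
    rw [finrank_prod, finrank_euclideanSpace_fin, finrank_self]
  have hsum := Submodule.finrank_sup_add_finrank_inf_eq V (LinearMap.range (definiteGraph (n := n) y c))
  have hle := (V ⊔ LinearMap.range (definiteGraph (n := n) y c)).finrank_le
  rw [finrank_fib] at hle
  have hne : V ⊓ LinearMap.range (definiteGraph (n := n) y c) ≠ ⊥ := fun h0 => by
    rw [h0, finrank_bot] at hsum
    omega
  obtain ⟨a, ⟨haV, p, rfl⟩, ha⟩ := Submodule.exists_mem_ne_zero_of_ne_bot hne
  refine ⟨_, haV, _, ?_, pairing_definiteGraph c p⟩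
  rcases eq_or_ne p.1 0 with h1 | h1
  · rcases eq_or_ne p.2 0 with h2 | h2
    · exact absurd (by rw [show p = 0 from Prod.ext h1 h2, map_zero]) ha
    · positivity
  · positivity

/-- By maximality, a null vector orthogonal to `W` already lies in `W`. If the orthogonal were
strictly larger than `W`, its dimension would exceed `n + 1`, so it would contain a positive and a
negative vector; a null combination of the two then lies in `W`, which contradicts their signs. -/
theorem isLagrangian_of_maximal {W : Submodule ℝ (Fib n y)} (hW : Maximal IsIsotropic W) :
    IsLagrangian W := by
  have hle : W ≤ (pairingForm y).orthogonal W := fun a ha b hb => hW.1 b hb a ha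
  have hnull : ∀ a ∈ (pairingForm y).orthogonal W, pairing a a = 0 → a ∈ W := by
    intro a ha h0
    have hiso : IsIsotropic (W ⊔ Submodule.span ℝ {a}) := by
      intro p hp q hq
      obtain ⟨w, hw, c, hc, rfl⟩ := Submodule.mem_sup.1 hp
      obtain ⟨w', hw', c', hc', rfl⟩ := Submodule.mem_sup.1 hq
      obtain ⟨t, rfl⟩ := Submodule.mem_span_singleton.1 hc
      obtain ⟨t', rfl⟩ := Submodule.mem_span_singleton.1 hc'
      have h1 : pairingForm y w w' = 0 := hW.1 w hw w' hw'
      have h2 : pairingForm y w a = 0 := ha w hw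
      have h3 : pairingForm y a w' = 0 := (pairing_comm (n := n) a w').trans (ha w' hw')
      have h4 : pairingForm y a a = 0 := h0
      rw [← pairingForm_apply]
      simp [h1, h2, h3, h4, -pairingForm_apply]
    exact hW.2 hiso le_sup_left (Submodule.mem_sup_right (Submodule.mem_span_singleton_self a))
  refine le_antisymm (fun p hp => ?_) hle
  by_contra hpW
  have hlt : W < (pairingForm y).orthogonal W := lt_of_le_of_ne hle fun h => hpW (h ▸ hp)
  have hdim := LinearMap.BilinForm.finrank_orthogonal (nondegenerate_pairingForm (n := n) (y := y)) W
  have hlt' := Submodule.finrank_lt_finrank_of_lt hlt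
  rw [finrank_fib] at hdim
  have hbig : n + 1 < finrank ℝ ((pairingForm y).orthogonal W) := by omega
  obtain ⟨a, ha, r, hr, har⟩ := exists_mem_definiteGraph _ hbig 1
  obtain ⟨b, hb, t, ht, hbt⟩ := exists_mem_definiteGraph _ hbig (-1)
  -- The number `u` is a root of the quadratic expressing that `a + u • b` is null; the opposite
  -- signs of `pairing a a` and `pairing b b` make the discriminant positive.
  obtain ⟨u, hu⟩ := exists_quadratic_eq_zero (a := pairing b b) (b := 2 * pairing a b)
    (c := pairing a a) (by rw [hbt]; linarith) ⟨Real.sqrt (discrim _ _ _), (Real.mul_self_sqrt (by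
      rw [discrim, har, hbt]; nlinarith [mul_pos hr ht, sq_nonneg (pairing a b)])).symm⟩
  have hexp : ∀ q : Fib n y, pairing (a + u • b) q = pairing a q + u * pairing b q := fun q => by
    simp only [← pairingForm_apply, map_add, map_smul, LinearMap.add_apply, LinearMap.smul_apply,
      smul_eq_mul]
  have hmem : a + u • b ∈ W := by
    refine hnull _ (Submodule.add_mem _ ha (Submodule.smul_mem _ _ hb)) ?_
    rw [hexp, pairing_comm a, pairing_comm b, hexp, hexp, pairing_comm b a]
    linarith
  have ha0 : pairing (a + u • b) a = 0 := ha _ hmem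
  have hb0 : pairing (a + u • b) b = 0 := hb _ hmem
  rw [hexp, pairing_comm b a] at ha0
  rw [hexp] at hb0
  -- Orthogonality of `a + u • b` to both `a` and `b` forces `pairing a a = u ^ 2 * pairing b b`, a
  -- positive number equal to a nonpositive one.
  nlinarith [mul_nonneg (sq_nonneg u) ht.le]

variable {W : Submodule ℝ (Fib n y)} {D : TangentSpace (𝓡 s) x →L[ℝ] TangentSpace (𝓡 n) y}

/-- The subspace `{0} ⊕ ((T_x S)° × {0})` of the fibre of `𝓔¹(M)`. -/
def conormalSpace (D : TangentSpace (𝓡 s) x →L[ℝ] TangentSpace (𝓡 n) y) :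
    Submodule ℝ (Fib n y) :=
  (⊥ : Submodule ℝ (TangentSpace (𝓡 n) y × ℝ)).prod ((annihilator D).prod ⊥)

theorem orthogonal_conormalSpace_le :
    (pairingForm y).orthogonal (conormalSpace D) ≤
      ((LinearMap.range D.toLinearMap).prod ⊤).prod ⊤ := by
  intro a ha
  refine ⟨⟨?_, trivial⟩, trivial⟩
  by_contra hne
  obtain ⟨β, hβ, hV⟩ := exists_form_vanishing _ hne
  have h := ha ((0, 0), (β, 0)) ⟨rfl, fun u => hV _ ⟨u, rfl⟩, rfl⟩
  exact hβ (by simpa [pairing] using h)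

theorem exists_extension (h : Function.Injective D) (β : TangentSpace (𝓡 s) x →L[ℝ] ℝ) :
    ∃ α : TangentSpace (𝓡 n) y →L[ℝ] ℝ, α.comp D = β := by
  obtain ⟨P, hP⟩ := LinearMap.exists_leftInverse_of_injective D.toLinearMap
    (LinearMap.ker_eq_bot.2 h)
  let f : TangentSpace (𝓡 n) y →ₗ[ℝ] ℝ := β.toLinearMap ∘ₗ P
  refine ⟨(LinearMap.toContinuousLinearMap (E := EuclideanSpace ℝ (Fin n)) (F' := ℝ) (𝕜 := ℝ) f :
    EuclideanSpace ℝ (Fin n) →L[ℝ] ℝ), ContinuousLinearMap.ext fun u => ?_⟩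
  exact congrArg β (LinearMap.congr_fun hP u)

/-- Related elements have equal pairings, so the image is isotropic. Conversely, let `q` be
orthogonal to the image and lift it to some `a` over `y`. The orthogonal of `W ⊔ conormalSpace D`
lies in `hat W D`, so `a` is orthogonal to it and therefore lies in `W ⊔ conormalSpace D`; the
conormal summand restricts to zero. -/
theorem IsLagrangian.range_restrict (hW : IsLagrangian W) (h : Function.Injective D) :
    IsLagrangian (LinearMap.range (restrict W D h)) := by
  have hpair : ∀ (a b : Fib n y) (p q : Fib s x), a.1.1 = D p.1.1 → a.1.2 = p.1.2 →
      a.2.1.comp D = p.2.1 → a.2.2 = p.2.2 → b.1.1 = D q.1.1 → b.1.2 = q.1.2 →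
      b.2.1.comp D = q.2.1 → b.2.2 = q.2.2 → pairing a b = pairing p q := by
    intro a b p q h1 h2 h3 h4 k1 k2 k3 k4
    simp only [pairing, h1, h2, h4, k1, k2, k4, ← h3, ← k3, ContinuousLinearMap.comp_apply]
  refine isLagrangian_iff.2 fun q => ⟨?_, fun hq => ?_⟩
  · rintro ⟨b, hb⟩ _ ⟨a, rfl⟩
    obtain ⟨h1, h2, h3, h4⟩ := (restrict_eq_iff W D h a _).1 rfl
    obtain ⟨k1, k2, k3, k4⟩ := (restrict_eq_iff W D h b _).1 hb
    rw [← hpair a.1 b.1 _ q h1 h2 h3 h4 k1 k2 k3 k4]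
    exact (hW.mem_iff _).1 b.2.1 _ a.2.1
  · obtain ⟨β, hβ⟩ := exists_extension h q.2.1
    let a : Fib n y := ((D q.1.1, q.1.2), (β, q.2.2))
    have hhat : (pairingForm y).orthogonal (W ⊔ conormalSpace D) ≤ hat W D := by
      intro b hb
      refine ⟨?_, orthogonal_conormalSpace_le fun c hc => hb c (Submodule.mem_sup_right hc)⟩
      exact (hW.mem_iff b).2 fun c hc => hb c (Submodule.mem_sup_left hc)
    have ha : a ∈ W ⊔ conormalSpace D := by
      rw [← LinearMap.BilinForm.orthogonal_orthogonal (nondegenerate_pairingForm (n := n) (y := y))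
        isRefl_pairingForm (W ⊔ conormalSpace D)]
      intro b hb
      obtain ⟨h1, h2, h3, h4⟩ := (restrict_eq_iff W D h ⟨b, hhat hb⟩ _).1 rfl
      have := hpair b a _ q h1 h2 h3 h4 rfl rfl hβ rfl
      exact this.trans (hq _ ⟨_, rfl⟩)
    obtain ⟨w, hw, c, ⟨hc1, hc2, hc3⟩, hwc⟩ := Submodule.mem_sup.1 ha
    have hc1 : c.1 = 0 := hc1
    have hc3 : c.2.2 = 0 := hc3
    have hw1 : w.1 = a.1 := by rw [← hwc]; simp [hc1]
    have hw2 : w.2.2 = a.2.2 := by rw [← hwc]; simp [hc3]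
    refine ⟨⟨w, hw, ⟨⟨q.1.1, ?_⟩, trivial⟩, trivial⟩, (restrict_eq_iff _ _ _ _ _).2
      ⟨congrArg Prod.fst hw1, congrArg Prod.snd hw1, ?_, hw2⟩⟩
    · exact (congrArg Prod.fst hw1).symm
    · rw [← hβ]
      refine ContinuousLinearMap.ext fun u => ?_
      have h1 : c.2.1 (D u) = 0 := hc2 u
      have h2 : (w + c).2.1 (D u) = β (D u) := by rw [hwc]
      simpa [h1] using h2

/-- Rank–nullity for `restrict`, whose image is Lagrangian of dimension `s + 1` and whose kernel is
`conormal W D`. -/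
theorem IsLagrangian.finrank_hat (hW : IsLagrangian W) (h : Function.Injective D) :
    finrank ℝ (hat W D) = s + 1 + finrank ℝ (conormal W D) := by
  have h1 := LinearMap.finrank_range_add_finrank_ker (restrict W D h)
  rw [(hW.range_restrict h).finrank_eq, ker_restrict] at h1
  have hle : conormal W D ≤ hat W D := by
    rintro a ⟨ha, ha1, ha2⟩
    have ha1 : a.1 = 0 := ha1
    exact ⟨ha, ⟨⟨0, by rw [ha1]; exact map_zero _⟩, trivial⟩, trivial⟩
  rw [← h1, (Submodule.submoduleOfEquivOfLe hle).finrank_eq]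

end LinearAlgebra

/-! ### Smooth solutions of linear equations of constant rank -/

section ConstantRank

open Module

theorem exists_generalized_inverse {V F : Type*} [AddCommGroup V] [Module ℝ V] [AddCommGroup F]
    [Module ℝ F] (f : V →ₗ[ℝ] F) : ∃ g : F →ₗ[ℝ] V, ∀ v, f (g (f v)) = f v := by
  obtain ⟨r, hr⟩ := f.rangeRestrict.exists_rightInverse_of_surjective f.range_rangeRestrict
  obtain ⟨P, hP⟩ := (LinearMap.range f).subtype.exists_leftInverse_of_injective
    (Submodule.ker_subtype _)
  refine ⟨r ∘ₗ P, fun v => ?_⟩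
  have h1 : P (f v) = f.rangeRestrict v := LinearMap.congr_fun hP (f.rangeRestrict v)
  have h2 := LinearMap.congr_fun hr (f.rangeRestrict v)
  rw [LinearMap.comp_apply, h1]
  exact congrArg Subtype.val h2

/-- A smooth family of linear equations of locally constant rank, solvable at each parameter, has
a smooth solution through any given solution at one parameter. -/
theorem exists_smooth_solution {E V F : Type*} [NormedAddCommGroup E] [NormedSpace ℝ E]
    [NormedAddCommGroup V] [NormedSpace ℝ V] [FiniteDimensional ℝ V]
    [NormedAddCommGroup F] [NormedSpace ℝ F] [FiniteDimensional ℝ F]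
    {G : E → V →L[ℝ] F} {b : E → F} {p : E} {c₀ : V}
    (hG : ∀ᶠ z in 𝓝 p, ContDiffAt ℝ ∞ G z) (hb : ∀ᶠ z in 𝓝 p, ContDiffAt ℝ ∞ b z)
    (hrank : ∀ᶠ z in 𝓝 p, finrank ℝ (LinearMap.ker (G z).toLinearMap) =
      finrank ℝ (LinearMap.ker (G p).toLinearMap))
    (hrange : ∀ᶠ z in 𝓝 p, ∃ d, G z d = b z) (h₀ : G p c₀ = b p) :
    ∃ c : E → V, (∀ᶠ z in 𝓝 p, ContDiffAt ℝ ∞ c z) ∧ c p = c₀ ∧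
      ∀ᶠ z in 𝓝 p, G z (c z) = b z := by
  have : CompleteSpace V := FiniteDimensional.complete ℝ V
  obtain ⟨g, hg⟩ := exists_generalized_inverse (G p).toLinearMap
  let Q : F →L[ℝ] V := LinearMap.toContinuousLinearMap g
  have hQ : ∀ v, G p (Q (G p v)) = G p v := hg
  -- Since `G p ∘ Q ∘ G p = G p`, one has `G p ∘ T z = G p ∘ Q ∘ G z`. Near `p` the map `T z` is
  -- invertible and carries the kernel of `G p ∘ Q ∘ G z` into that of `G p`.
  let T : E → V →L[ℝ] V := fun z => 1 + Q.comp (G z - G p)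
  have hT : ∀ z v, T z v = v + Q (G z v - G p v) := fun z v => rfl
  have hTp : T p = 1 := by ext v; simp [hT]
  have hTs : ∀ᶠ z in 𝓝 p, ContDiffAt ℝ ∞ T z := hG.mono fun z hz =>
    contDiffAt_const.add (contDiffAt_const.clm_comp (hz.sub contDiffAt_const))
  have hunit : ∀ᶠ z in 𝓝 p, IsUnit (T z) := by
    have h1 : ContinuousAt T p := hTs.self_of_nhds.continuousAt
    refine h1.eventually (Units.isOpen.mem_nhds ?_)
    rw [hTp]; exact isUnit_one
  refine ⟨fun z => Ring.inverse (T z) (c₀ - Q (G p c₀) + Q (b z)), ?_, ?_, ?_⟩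
  · filter_upwards [hb, hTs, hunit] with z h1 h2 h3
    obtain ⟨u, hu⟩ := h3
    have h4 : ContDiffAt ℝ ∞ Ring.inverse (T z) := hu ▸ contDiffAt_ringInverse ℝ u
    exact (ContDiffAt.comp z h4 h2).clm_apply
      (contDiffAt_const.add (contDiffAt_const.clm_apply h1))
  · simp [hTp, ← h₀]
  · filter_upwards [hrank, hrange, hunit] with z h1 ⟨d, hd⟩ hu
    set c := Ring.inverse (T z) (c₀ - Q (G p c₀) + Q (b z)) with hc
    have hTc : T z c = c₀ - Q (G p c₀) + Q (b z) := by
      exact DFunLike.congr_fun (Ring.mul_inverse_cancel (T z) hu) _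
    have hinj : Function.Injective (T z) :=
      Function.LeftInverse.injective (g := ⇑(Ring.inverse (T z))) fun v =>
        DFunLike.congr_fun (Ring.inverse_mul_cancel (T z) hu) v
    let H : V →ₗ[ℝ] F := (G p).toLinearMap ∘ₗ g ∘ₗ (G z).toLinearMap
    have hH : ∀ v, H v = G p (Q (G z v)) := fun v => rfl
    have hGT : ∀ v, G p (T z v) = H v := fun v => by
      rw [hT, hH, map_sub, map_add, map_sub, hQ]; abel
    have hle : LinearMap.ker (G z).toLinearMap ≤ LinearMap.ker H := fun v hv => by
      have hv : G z v = 0 := hv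
      change H v = 0
      rw [hH, hv, map_zero, map_zero]
    have hdim : finrank ℝ (LinearMap.ker H) ≤ finrank ℝ (LinearMap.ker (G z).toLinearMap) := by
      have hmaps : ∀ v ∈ LinearMap.ker H, (T z).toLinearMap v ∈ LinearMap.ker (G p).toLinearMap :=
        fun v hv => (hGT v).trans hv
      rw [h1]
      refine LinearMap.finrank_le_finrank_of_injective
        (f := (T z).toLinearMap.restrict hmaps) fun v w h => ?_
      exact Subtype.ext (hinj (congrArg Subtype.val h))
    -- This is where constant rank enters: applying `G p ∘ Q` to `G z` does not enlarge the kernel.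
    -- Hence the candidate `c` differs from an actual solution `d` by an element of the kernel of `G
    -- z`.
    have heq := Submodule.eq_of_le_of_finrank_le hle hdim
    have hmem : c - d ∈ LinearMap.ker H := by
      change H (c - d) = 0
      rw [map_sub, ← hGT c, hTc, map_add, map_sub, hQ, hH d, hd]; abel
    rw [← heq] at hmem
    have h3 : G z (c - d) = 0 := hmem
    rw [map_sub, hd, sub_eq_zero] at h3
    exact h3

end ConstantRank

/-! ### Sections and their smoothness in a chart -/

section Coordinates

variable {n : ℕ} {M : Type*} [TopologicalSpace M] [ChartedSpace (EuclideanSpace ℝ (Fin n)) M]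

/-- The model fibre `(ℝⁿ × ℝ) ⊕ ((ℝⁿ)^* × ℝ)` of `𝓔¹(M)`. -/
abbrev ModelFib (n : ℕ) : Type :=
  (EuclideanSpace ℝ (Fin n) × ℝ) × ((EuclideanSpace ℝ (Fin n) →L[ℝ] ℝ) × ℝ)

/-- The differential at `x` of the preferred chart at `x₀`. -/
def chartDeriv (x₀ x : M) : TangentSpace (𝓡 n) x →L[ℝ] EuclideanSpace ℝ (Fin n) :=
  mfderiv (𝓡 n) 𝓘(ℝ, EuclideanSpace ℝ (Fin n)) (extChartAt (𝓡 n) x₀) x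

/-- The inverse of the differential at `x` of the preferred chart at `x₀`. -/
def chartDerivInv (x₀ x : M) : EuclideanSpace ℝ (Fin n) →L[ℝ] TangentSpace (𝓡 n) x :=
  (chartDeriv x₀ x).inverse

/-- The coordinates, in the preferred chart at `x₀`, of an element of a fibre of `𝓔¹(M)`. -/
def coord (x₀ x : M) : Fib n x →ₗ[ℝ] ModelFib n where
  toFun a := ((chartDeriv x₀ x a.1.1, a.1.2), (a.2.1.comp (chartDerivInv x₀ x), a.2.2))
  map_add' a b := Prod.ext (Prod.ext (map_add (chartDeriv x₀ x) a.1.1 b.1.1) rfl)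
    (Prod.ext (ContinuousLinearMap.ext fun _ => rfl) rfl)
  map_smul' c a := Prod.ext (Prod.ext (map_smul (chartDeriv x₀ x) c a.1.1) rfl)
    (Prod.ext (ContinuousLinearMap.ext fun _ => rfl) rfl)

/-- The element of a fibre of `𝓔¹(M)` with given coordinates in the preferred chart at `x₀`. -/
def ofCoord (x₀ x : M) (m : ModelFib n) : Fib n x :=
  ((chartDerivInv x₀ x m.1.1, m.1.2), (m.2.1.comp (chartDeriv x₀ x), m.2.2))

/-- A section of `𝓔¹(M)` read in the preferred chart at `x₀`. -/
def chartSec (e : ∀ x : M, Fib n x) (x₀ : M) (y : EuclideanSpace ℝ (Fin n)) : ModelFib n :=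
  coord x₀ ((extChartAt (𝓡 n) x₀).symm y) (e ((extChartAt (𝓡 n) x₀).symm y))

variable [IsManifold (𝓡 n) ∞ M] {x₀ x : M}

theorem isInvertible_chartDeriv (hx : x ∈ (chartAt (EuclideanSpace ℝ (Fin n)) x₀).source) :
    (chartDeriv (n := n) x₀ x).IsInvertible :=
  isInvertible_mfderiv_extChartAt (by rwa [extChartAt_source])

theorem chartDeriv_chartDerivInv (hx : x ∈ (chartAt (EuclideanSpace ℝ (Fin n)) x₀).source)
    (u : EuclideanSpace ℝ (Fin n)) : chartDeriv x₀ x (chartDerivInv x₀ x u) = u :=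
  (isInvertible_chartDeriv hx).self_apply_inverse u

theorem chartDerivInv_chartDeriv (hx : x ∈ (chartAt (EuclideanSpace ℝ (Fin n)) x₀).source)
    (u : TangentSpace (𝓡 n) x) : chartDerivInv x₀ x (chartDeriv x₀ x u) = u :=
  (isInvertible_chartDeriv hx).inverse_apply_self u

theorem coord_ofCoord (hx : x ∈ (chartAt (EuclideanSpace ℝ (Fin n)) x₀).source)
    (m : ModelFib n) : coord x₀ x (ofCoord x₀ x m) = m :=
  Prod.ext (Prod.ext (chartDeriv_chartDerivInv hx _) rfl)
    (Prod.ext (ContinuousLinearMap.ext fun u => congrArg m.2.1 (chartDeriv_chartDerivInv hx u)) rfl)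

theorem ofCoord_coord (hx : x ∈ (chartAt (EuclideanSpace ℝ (Fin n)) x₀).source)
    (a : Fib n x) : ofCoord x₀ x (coord x₀ x a) = a :=
  Prod.ext (Prod.ext (chartDerivInv_chartDeriv hx _) rfl)
    (Prod.ext (ContinuousLinearMap.ext fun u => congrArg a.2.1 (chartDerivInv_chartDeriv hx u)) rfl)

theorem coord_injective (hx : x ∈ (chartAt (EuclideanSpace ℝ (Fin n)) x₀).source) :
    Function.Injective (coord (n := n) x₀ x) :=
  Function.LeftInverse.injective (ofCoord_coord hx)

/-- Smoothness at a point of a section of `𝓔¹(M)`. -/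
structure SmoothAt (e : ∀ x : M, Fib n x) (x : M) : Prop where
  field : ContMDiffAt (𝓡 n) ((𝓡 n).prod 𝓘(ℝ, EuclideanSpace ℝ (Fin n))) ∞
    (fun x => Bundle.TotalSpace.mk' (EuclideanSpace ℝ (Fin n))
      (E := fun x : M => TangentSpace (𝓡 n) x) x (e x).1.1) x
  fst : ContMDiffAt (𝓡 n) 𝓘(ℝ, ℝ) ∞ (fun x => (e x).1.2) x
  form : ContMDiffAt (𝓡 n) ((𝓡 n).prod 𝓘(ℝ, EuclideanSpace ℝ (Fin n) →L[ℝ] ℝ)) ∞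
    (fun x => Bundle.TotalSpace.mk' (EuclideanSpace ℝ (Fin n) →L[ℝ] ℝ)
      (E := fun x : M => TangentSpace (𝓡 n) x →L[ℝ] Bundle.Trivial M ℝ x) x (e x).2.1) x
  snd : ContMDiffAt (𝓡 n) 𝓘(ℝ, ℝ) ∞ (fun x => (e x).2.2) x

theorem SmoothOn.smoothAt {e : ∀ x : M, Fib n x} {U : Set M} (he : SmoothOn e U) (hU : IsOpen U)
    (hx : x ∈ U) : SmoothAt e x :=
  ⟨he.field.contMDiffAt (hU.mem_nhds hx), he.fst.contMDiffAt (hU.mem_nhds hx),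
    he.form.contMDiffAt (hU.mem_nhds hx), he.snd.contMDiffAt (hU.mem_nhds hx)⟩

theorem smoothOn_of_smoothAt {e : ∀ x : M, Fib n x} {U : Set M} (he : ∀ x ∈ U, SmoothAt e x) :
    SmoothOn e U :=
  ⟨fun x hx => (he x hx).field.contMDiffWithinAt, fun x hx => (he x hx).fst.contMDiffWithinAt,
    fun x hx => (he x hx).form.contMDiffWithinAt, fun x hx => (he x hx).snd.contMDiffWithinAt⟩

theorem contMDiffAt_field_iff {X : ∀ x : M, TangentSpace (𝓡 n) x}
    (hx : x ∈ (chartAt (EuclideanSpace ℝ (Fin n)) x₀).source) :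
    ContMDiffAt (𝓡 n) ((𝓡 n).prod 𝓘(ℝ, EuclideanSpace ℝ (Fin n))) ∞
      (fun x => Bundle.TotalSpace.mk' (EuclideanSpace ℝ (Fin n))
        (E := fun x : M => TangentSpace (𝓡 n) x) x (X x)) x ↔
    ContMDiffAt (𝓡 n) 𝓘(ℝ, EuclideanSpace ℝ (Fin n)) ∞ (fun x => chartDeriv x₀ x (X x)) x := by
  rw [(trivializationAt (EuclideanSpace ℝ (Fin n))
    (fun x : M => TangentSpace (𝓡 n) x) x₀).contMDiffAt_section_iff hx]
  refine Filter.EventuallyEq.contMDiffAt_iff ?_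
  filter_upwards [(chartAt (EuclideanSpace ℝ (Fin n)) x₀).open_source.mem_nhds hx] with z hz
  have h := DFunLike.congr_fun
    (TangentBundle.continuousLinearMapAt_trivializationAt (I := 𝓡 n) hz) (X z)
  refine Eq.trans ?_ h
  exact (congrFun (Bundle.Trivialization.coe_linearMapAt_of_mem (R := ℝ)
    (trivializationAt (EuclideanSpace ℝ (Fin n)) (fun x : M => TangentSpace (𝓡 n) x) x₀) hz)
      (X z)).symm

/-- The trivialization of the cotangent bundle precomposes a covector with the inverse of the
tangent trivialization, and that inverse is `chartDerivInv` over the chart domain. -/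
theorem contMDiffAt_form_iff {α : ∀ x : M, TangentSpace (𝓡 n) x →L[ℝ] ℝ}
    (hx : x ∈ (chartAt (EuclideanSpace ℝ (Fin n)) x₀).source) :
    ContMDiffAt (𝓡 n) ((𝓡 n).prod 𝓘(ℝ, EuclideanSpace ℝ (Fin n) →L[ℝ] ℝ)) ∞
      (fun x => Bundle.TotalSpace.mk' (EuclideanSpace ℝ (Fin n) →L[ℝ] ℝ)
        (E := fun x : M => TangentSpace (𝓡 n) x →L[ℝ] Bundle.Trivial M ℝ x) x (α x)) x ↔
    ContMDiffAt (𝓡 n) 𝓘(ℝ, EuclideanSpace ℝ (Fin n) →L[ℝ] ℝ) ∞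
      (fun x => (α x).comp (chartDerivInv x₀ x)) x := by
  rw [(trivializationAt (EuclideanSpace ℝ (Fin n) →L[ℝ] ℝ)
    (fun x : M => TangentSpace (𝓡 n) x →L[ℝ] Bundle.Trivial M ℝ x) x₀).contMDiffAt_section_iff
      ⟨hx, trivial⟩]
  refine Filter.EventuallyEq.contMDiffAt_iff ?_
  filter_upwards [(chartAt (EuclideanSpace ℝ (Fin n)) x₀).open_source.mem_nhds hx] with z hz
  have hT := TangentBundle.continuousLinearMapAt_trivializationAt (I := 𝓡 n) hz
  have hinv : (trivializationAt (EuclideanSpace ℝ (Fin n))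
      (fun x : M => TangentSpace (𝓡 n) x) x₀).symmL ℝ z = chartDerivInv x₀ z := by
    refine (ContinuousLinearMap.inverse_eq ?_ ?_).symm
    · ext1 u
      refine (DFunLike.congr_fun hT _).symm.trans ?_
      exact Bundle.Trivialization.continuousLinearMapAt_symmL (R := ℝ) _ hz u
    · ext1 u
      refine Eq.trans ?_ (Bundle.Trivialization.symmL_continuousLinearMapAt (R := ℝ)
        (trivializationAt (EuclideanSpace ℝ (Fin n)) (fun x : M => TangentSpace (𝓡 n) x) x₀) hz u)
      exact congrArg _ (DFunLike.congr_fun hT u).symm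
  refine ContinuousLinearMap.ext fun u => ?_
  have h := DFunLike.congr_fun hinv u
  refine Eq.trans ?_ (congrArg (α z) h)
  rw [hom_trivializationAt, Bundle.Trivialization.continuousLinearMap_apply]
  exact DFunLike.congr_fun
    (Bundle.Trivial.continuousLinearMapAt_trivialization ℝ M ℝ z) _

theorem contMDiffAt_iff_chart {F : Type*} [NormedAddCommGroup F] [NormedSpace ℝ F] {g : M → F}
    (hx : x ∈ (chartAt (EuclideanSpace ℝ (Fin n)) x₀).source) :
    ContMDiffAt (𝓡 n) 𝓘(ℝ, F) ∞ g x ↔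
      ContDiffAt ℝ ∞ (g ∘ (extChartAt (𝓡 n) x₀).symm) (extChartAt (𝓡 n) x₀ x) := by
  rw [contMDiffAt_iff_source_of_mem_source hx]
  rw [ModelWithCorners.range_eq_univ, contMDiffWithinAt_univ, contMDiffAt_iff_contDiffAt]

theorem smoothAt_iff {e : ∀ x : M, Fib n x}
    (hx : x ∈ (chartAt (EuclideanSpace ℝ (Fin n)) x₀).source) :
    SmoothAt e x ↔ ContDiffAt ℝ ∞ (chartSec e x₀) (extChartAt (𝓡 n) x₀ x) := by
  have h : SmoothAt e x ↔ (ContMDiffAt (𝓡 n) 𝓘(ℝ, EuclideanSpace ℝ (Fin n)) ∞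
      (fun x => chartDeriv x₀ x (e x).1.1) x ∧ ContMDiffAt (𝓡 n) 𝓘(ℝ, ℝ) ∞ (fun x => (e x).1.2) x) ∧
      (ContMDiffAt (𝓡 n) 𝓘(ℝ, EuclideanSpace ℝ (Fin n) →L[ℝ] ℝ) ∞
        (fun x => (e x).2.1.comp (chartDerivInv x₀ x)) x ∧
      ContMDiffAt (𝓡 n) 𝓘(ℝ, ℝ) ∞ (fun x => (e x).2.2) x) := by
    rw [← contMDiffAt_field_iff hx, ← contMDiffAt_form_iff hx]
    exact ⟨fun h => ⟨⟨h.1, h.2⟩, ⟨h.3, h.4⟩⟩, fun h => ⟨h.1.1, h.1.2, h.2.1, h.2.2⟩⟩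
  rw [h, contMDiffAt_iff_chart hx, contMDiffAt_iff_chart hx,
    contMDiffAt_iff_chart hx, contMDiffAt_iff_chart hx]
  constructor
  · rintro ⟨⟨h1, h2⟩, ⟨h3, h4⟩⟩
    exact (h1.prodMk h2).prodMk (h3.prodMk h4)
  · intro h
    exact ⟨⟨h.fst.fst, h.fst.snd⟩, ⟨h.snd.fst, h.snd.snd⟩⟩

/-- Order `∞` at a single point gives a neighbourhood for each finite order but no common one, so
smoothness near a point is carried as an eventual statement. -/
theorem eventually_smoothAt_iff {e : ∀ x : M, Fib n x} :
    (∀ᶠ x in 𝓝 x₀, SmoothAt e x) ↔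
      ∀ᶠ y in 𝓝 (extChartAt (𝓡 n) x₀ x₀), ContDiffAt ℝ ∞ (chartSec e x₀) y := by
  have hs := (chartAt (EuclideanSpace ℝ (Fin n)) x₀).open_source.mem_nhds
    (mem_chart_source (EuclideanSpace ℝ (Fin n)) x₀)
  constructor
  · intro h
    have h1 : Filter.Tendsto (extChartAt (𝓡 n) x₀).symm (𝓝 (extChartAt (𝓡 n) x₀ x₀)) (𝓝 x₀) := by
      have := continuousAt_extChartAt_symm (I := 𝓡 n) x₀
      rwa [ContinuousAt, extChartAt_to_inv] at this
    filter_upwards [h1.eventually h, h1.eventually hs, extChartAt_target_mem_nhds x₀]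
      with y h2 h3 h4
    rw [smoothAt_iff h3, (extChartAt (𝓡 n) x₀).right_inv h4] at h2
    exact h2
  · intro h
    filter_upwards [(continuousAt_extChartAt x₀).eventually h, hs] with x h1 h2
    exact (smoothAt_iff h2).2 h1

end Coordinates

/-! ### Naturality of the bracket for maps between vector spaces -/

section FlatBracket

variable {U V : Type*} [NormedAddCommGroup U] [NormedSpace ℝ U]
  [NormedAddCommGroup V] [NormedSpace ℝ V]

/-- The elements `a = (X, f) + (α, g)` and `q = (u, φ) + (β, ψ)` are related by the linear map `D`
if `X = D u`, `f = φ`, `α ∘ D = β` and `g = ψ`. -/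
def Rel {U V : Type*} [AddCommGroup U] [Module ℝ U] [TopologicalSpace U]
    [AddCommGroup V] [Module ℝ V] [TopologicalSpace V] (D : U →L[ℝ] V)
    (a : (V × ℝ) × ((V →L[ℝ] ℝ) × ℝ)) (q : (U × ℝ) × ((U →L[ℝ] ℝ) × ℝ)) : Prop :=
  a.1.1 = D q.1.1 ∧ a.1.2 = q.1.2 ∧ a.2.1.comp D = q.2.1 ∧ a.2.2 = q.2.2

/-- The Lie derivative of a one-form on a vector space. -/
def flatLieForm (X : V → V) (α : V → V →L[ℝ] ℝ) (p : V) : V →L[ℝ] ℝ :=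
  fderiv ℝ α p (X p) - (fderiv ℝ α p).flip (X p) + fderiv ℝ (fun y => α y (X y)) p

/-- The bracket of sections of `𝓔¹(V)` for a vector space `V`. -/
def flatBracket (e₁ e₂ : V → (V × ℝ) × ((V →L[ℝ] ℝ) × ℝ)) (p : V) :
    (V × ℝ) × ((V →L[ℝ] ℝ) × ℝ) :=
  ((fderiv ℝ (fun y => (e₂ y).1.1) p (e₁ p).1.1 - fderiv ℝ (fun y => (e₁ y).1.1) p (e₂ p).1.1,
    fderiv ℝ (fun y => (e₂ y).1.2) p (e₁ p).1.1 - fderiv ℝ (fun y => (e₁ y).1.2) p (e₂ p).1.1),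
   (flatLieForm (fun y => (e₁ y).1.1) (fun y => (e₂ y).2.1) p
      - flatLieForm (fun y => (e₂ y).1.1) (fun y => (e₁ y).2.1) p
      + (1 / 2 : ℝ) • fderiv ℝ (fun y => (e₁ y).2.1 (e₂ y).1.1 - (e₂ y).2.1 (e₁ y).1.1) p
      + (e₁ p).1.2 • (e₂ p).2.1 - (e₂ p).1.2 • (e₁ p).2.1
      + (1 / 2 : ℝ) • ((e₂ p).2.2 • fderiv ℝ (fun y => (e₁ y).1.2) p
          - (e₁ p).2.2 • fderiv ℝ (fun y => (e₂ y).1.2) p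
          - (e₁ p).1.2 • fderiv ℝ (fun y => (e₂ y).2.2) p
          + (e₂ p).1.2 • fderiv ℝ (fun y => (e₁ y).2.2) p),
    fderiv ℝ (fun y => (e₂ y).2.2) p (e₁ p).1.1 - fderiv ℝ (fun y => (e₁ y).2.2) p (e₂ p).1.1
      + (1 / 2) * ((e₁ p).2.1 (e₂ p).1.1 - (e₂ p).2.1 (e₁ p).1.1
          - (e₂ p).1.2 * (e₁ p).2.2 + (e₁ p).1.2 * (e₂ p).2.2)))

variable {j : U → V} {p : U}

theorem fderiv_related_function {F : Type*} [NormedAddCommGroup F] [NormedSpace ℝ F]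
    (hj : DifferentiableAt ℝ j p) {f : V → F} {φ : U → F} (hf : DifferentiableAt ℝ f (j p))
    (h : ∀ᶠ z in 𝓝 p, f (j z) = φ z) (w : U) : fderiv ℝ f (j p) (fderiv ℝ j p w) = fderiv ℝ φ p w := by
  have h1 : (f ∘ j) =ᶠ[𝓝 p] φ := h
  rw [← h1.fderiv_eq, fderiv_comp p hf hj]
  rfl

/-- Differentiating `X ∘ j = Dj · u` by the product rule leaves a second-derivative term of `j`; it
cancels in a commutator. -/
theorem fderiv_related_field (hj : ContDiffAt ℝ ∞ j p) {X : V → V} {u : U → U}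
    (hX : DifferentiableAt ℝ X (j p)) (hu : DifferentiableAt ℝ u p)
    (h : ∀ᶠ z in 𝓝 p, X (j z) = fderiv ℝ j z (u z)) (w : U) :
    fderiv ℝ X (j p) (fderiv ℝ j p w) =
      fderiv ℝ (fderiv ℝ j) p w (u p) + fderiv ℝ j p (fderiv ℝ u p w) := by
  have hj1 : DifferentiableAt ℝ j p := hj.differentiableAt (by simp)
  have hj2 : DifferentiableAt ℝ (fderiv ℝ j) p :=
    (hj.fderiv_right (m := ∞) (by simp)).differentiableAt (by simp)
  rw [fderiv_related_function hj1 hX h, fderiv_clm_apply hj2 hu]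
  simp [add_comm]

theorem fderiv_related_form (hj : ContDiffAt ℝ ∞ j p) {α : V → V →L[ℝ] ℝ} {β : U → U →L[ℝ] ℝ}
    (hα : DifferentiableAt ℝ α (j p))
    (h : ∀ᶠ z in 𝓝 p, (α (j z)).comp (fderiv ℝ j z) = β z) (w v : U) :
    fderiv ℝ β p w v = fderiv ℝ α (j p) (fderiv ℝ j p w) (fderiv ℝ j p v) +
      α (j p) (fderiv ℝ (fderiv ℝ j) p w v) := by
  have hj1 : DifferentiableAt ℝ j p := hj.differentiableAt (by simp)
  have hj2 : DifferentiableAt ℝ (fderiv ℝ j) p :=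
    (hj.fderiv_right (m := ∞) (by simp)).differentiableAt (by simp)
  have h1 : (fun z => (α (j z)).comp (fderiv ℝ j z)) =ᶠ[𝓝 p] β := h
  have h2 : fderiv ℝ (fun z => α (j z)) p = (fderiv ℝ α (j p)).comp (fderiv ℝ j p) :=
    fderiv_comp p hα hj1
  have hαj : DifferentiableAt ℝ (fun z => α (j z)) p := hα.comp p hj1
  rw [← h1.fderiv_eq, fderiv_clm_comp hαj hj2, h2]
  simp [add_comm]

/-- Relatedness is differentiated componentwise. Second derivatives of `j` enter only through the
Lie bracket and the exterior derivatives, antisymmetrised in both cases, so the symmetry of `fderiv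
ℝ (fderiv ℝ j) p` removes them. -/
theorem rel_flatBracket (hj : ContDiffAt ℝ ∞ j p)
    {e₁ e₂ : V → (V × ℝ) × ((V →L[ℝ] ℝ) × ℝ)} {ε₁ ε₂ : U → (U × ℝ) × ((U →L[ℝ] ℝ) × ℝ)}
    (he₁ : DifferentiableAt ℝ e₁ (j p)) (he₂ : DifferentiableAt ℝ e₂ (j p))
    (hε₁ : DifferentiableAt ℝ ε₁ p) (hε₂ : DifferentiableAt ℝ ε₂ p)
    (h₁ : ∀ᶠ z in 𝓝 p, Rel (fderiv ℝ j z) (e₁ (j z)) (ε₁ z))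
    (h₂ : ∀ᶠ z in 𝓝 p, Rel (fderiv ℝ j z) (e₂ (j z)) (ε₂ z)) :
    Rel (fderiv ℝ j p) (flatBracket e₁ e₂ (j p)) (flatBracket ε₁ ε₂ p) := by
  have hj1 : DifferentiableAt ℝ j p := hj.differentiableAt (by simp)
  have hsymm : ∀ v w, fderiv ℝ (fderiv ℝ j) p v w = fderiv ℝ (fderiv ℝ j) p w v :=
    (hj.isSymmSndFDerivAt (by
      rw [minSmoothness_of_isRCLikeNormedField]; exact ENat.LEInfty.out)).eq
  have hαX : ∀ {e e' : V → (V × ℝ) × ((V →L[ℝ] ℝ) × ℝ)} {ε ε' : U → (U × ℝ) × ((U →L[ℝ] ℝ) × ℝ)},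
      (∀ᶠ z in 𝓝 p, Rel (fderiv ℝ j z) (e (j z)) (ε z)) →
      (∀ᶠ z in 𝓝 p, Rel (fderiv ℝ j z) (e' (j z)) (ε' z)) →
      ∀ᶠ z in 𝓝 p, (e (j z)).2.1 (e' (j z)).1.1 = (ε z).2.1 (ε' z).1.1 := fun h h' => by
    filter_upwards [h, h'] with z hz hz'
    rw [hz'.1, ← hz.2.2.1]; rfl
  have hX₁ := fderiv_related_field hj he₁.fst.fst hε₁.fst.fst (h₁.mono fun z hz => hz.1)
  have hX₂ := fderiv_related_field hj he₂.fst.fst hε₂.fst.fst (h₂.mono fun z hz => hz.1)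
  have hf₁ := fderiv_related_function hj1 he₁.fst.snd (h₁.mono fun z hz => hz.2.1)
  have hf₂ := fderiv_related_function hj1 he₂.fst.snd (h₂.mono fun z hz => hz.2.1)
  have hα₁ := fderiv_related_form hj he₁.snd.fst (h₁.mono fun z hz => hz.2.2.1)
  have hα₂ := fderiv_related_form hj he₂.snd.fst (h₂.mono fun z hz => hz.2.2.1)
  have hg₁ := fderiv_related_function hj1 he₁.snd.snd (h₁.mono fun z hz => hz.2.2.2)
  have hg₂ := fderiv_related_function hj1 he₂.snd.snd (h₂.mono fun z hz => hz.2.2.2)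
  have h₁₂ := fderiv_related_function hj1 (he₁.snd.fst.clm_apply he₂.fst.fst) (hαX h₁ h₂)
  have h₂₁ := fderiv_related_function hj1 (he₂.snd.fst.clm_apply he₁.fst.fst) (hαX h₂ h₁)
  have hd := fderiv_related_function hj1
    (f := fun y => (e₁ y).2.1 (e₂ y).1.1 - (e₂ y).2.1 (e₁ y).1.1) ((he₁.snd.fst.clm_apply he₂.fst.fst).sub
    (he₂.snd.fst.clm_apply he₁.fst.fst)) (((hαX h₁ h₂).and (hαX h₂ h₁)).mono
      fun z hz => congrArg₂ (· - ·) hz.1 hz.2)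
  obtain ⟨a1, a2, a3, a4⟩ := h₁.self_of_nhds
  obtain ⟨b1, b2, b3, b4⟩ := h₂.self_of_nhds
  have a3' : ∀ v, (e₁ (j p)).2.1 (fderiv ℝ j p v) = (ε₁ p).2.1 v := fun v => DFunLike.congr_fun a3 v
  have b3' : ∀ v, (e₂ (j p)).2.1 (fderiv ℝ j p v) = (ε₂ p).2.1 v := fun v => DFunLike.congr_fun b3 v
  refine ⟨?_, ?_, ?_, ?_⟩
  · simp only [flatBracket]
    rw [a1, b1, hX₁, hX₂, map_sub, hsymm]
    abel
  · simp only [flatBracket]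
    rw [a1, b1, hf₁, hf₂]
  · ext v
    simp only [flatBracket, flatLieForm, ContinuousLinearMap.comp_apply, add_apply,
      sub_apply, smul_apply, ContinuousLinearMap.flip_apply]
    rw [a1, b1, a2, b2, a4, b4, a3', b3', hf₁, hf₂, hg₁, hg₂, h₁₂, h₂₁, hα₁, hα₁, hα₂, hα₂, hd,
      hsymm v, hsymm v]
    simp only [smul_eq_mul]
    ring
  · simp only [flatBracket]
    rw [a1, b1, hg₁, hg₂, a3', b3', a2, b2, a4, b4]

end FlatBracket

/-! ### The bracket on a manifold computed in a chart -/

section BracketInCoordinates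

variable {n : ℕ} {M : Type*} [TopologicalSpace M] [ChartedSpace (EuclideanSpace ℝ (Fin n)) M]
  {x₀ x : M}

theorem chartSec_apply (e : ∀ x : M, Fib n x)
    (hx : x ∈ (chartAt (EuclideanSpace ℝ (Fin n)) x₀).source) :
    chartSec e x₀ (extChartAt (𝓡 n) x₀ x) = coord x₀ x (e x) := by
  unfold chartSec
  rw [(extChartAt (𝓡 n) x₀).left_inv (by rwa [extChartAt_source])]

theorem symm_mem_source {y : EuclideanSpace ℝ (Fin n)} (hy : y ∈ (extChartAt (𝓡 n) x₀).target) :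
    (extChartAt (𝓡 n) x₀).symm y ∈ (chartAt (EuclideanSpace ℝ (Fin n)) x₀).source := by
  have := (extChartAt (𝓡 n) x₀).map_target hy
  rwa [extChartAt_source] at this

variable [IsManifold (𝓡 n) ∞ M]

theorem mfderiv_extChartAt_symm {y : EuclideanSpace ℝ (Fin n)}
    (hy : y ∈ (extChartAt (𝓡 n) x₀).target) :
    mfderiv 𝓘(ℝ, EuclideanSpace ℝ (Fin n)) (𝓡 n) (extChartAt (𝓡 n) x₀).symm y =
      chartDerivInv x₀ ((extChartAt (𝓡 n) x₀).symm y) := by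
  have h := mfderiv_extChartAt_comp_mfderivWithin_extChartAt_symm (I := 𝓡 n) hy
  rw [ModelWithCorners.range_eq_univ, mfderivWithin_univ] at h
  have hs := symm_mem_source hy
  refine ContinuousLinearMap.ext fun u => ?_
  refine (chartDerivInv_chartDeriv hs _).symm.trans ?_
  exact congrArg _ (DFunLike.congr_fun h u)

theorem mvfderiv_eq_fderiv {h : M → ℝ} (hh : ContMDiffAt (𝓡 n) 𝓘(ℝ, ℝ) ∞ h x)
    {g : EuclideanSpace ℝ (Fin n) → ℝ}
    (hg : ∀ᶠ y in 𝓝 (extChartAt (𝓡 n) x x), h ((extChartAt (𝓡 n) x).symm y) = g y)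
    (v : TangentSpace (𝓡 n) x) :
    mvfderiv (𝓡 n) h x v = fderiv ℝ g (extChartAt (𝓡 n) x x) (chartDeriv x x v) := by
  have hd : MDifferentiableAt (𝓡 n) 𝓘(ℝ, ℝ) h x := hh.mdifferentiableAt (by simp)
  have h1 : mfderiv (𝓡 n) 𝓘(ℝ, ℝ) h x = fderivWithin ℝ (writtenInExtChartAt (𝓡 n) 𝓘(ℝ, ℝ) x h)
    (Set.range (𝓡 n)) (extChartAt (𝓡 n) x x) := hd.mfderiv
  rw [ModelWithCorners.range_eq_univ, fderivWithin_univ] at h1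
  have h2 : writtenInExtChartAt (𝓡 n) 𝓘(ℝ, ℝ) x h =ᶠ[𝓝 (extChartAt (𝓡 n) x x)] g := hg
  rw [h2.fderiv_eq] at h1
  have h3 := DFunLike.congr_fun (mfderiv_extChartAt_self (I := 𝓡 n) (x := x)) v
  exact (DFunLike.congr_fun h1 v).trans
    (congrArg (fderiv ℝ g (extChartAt (𝓡 n) x x)) h3.symm)

/-- The manifold bracket is the flat bracket of the pullbacks under the inverse chart, and pulling
back by the inverse chart is pushing forward by the differential of the chart. -/
theorem chartDeriv_mlieBracket (X Y : ∀ x : M, TangentSpace (𝓡 n) x) :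
    chartDeriv x x (VectorField.mlieBracket (𝓡 n) X Y x) =
      VectorField.lieBracket ℝ
        (fun y => chartDeriv x ((extChartAt (𝓡 n) x).symm y) (X ((extChartAt (𝓡 n) x).symm y)))
        (fun y => chartDeriv x ((extChartAt (𝓡 n) x).symm y) (Y ((extChartAt (𝓡 n) x).symm y)))
        (extChartAt (𝓡 n) x x) := by
  have hpull : ∀ Z : ∀ x : M, TangentSpace (𝓡 n) x,
      VectorField.mpullbackWithin 𝓘(ℝ, EuclideanSpace ℝ (Fin n)) (𝓡 n) (extChartAt (𝓡 n) x).symm Z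
        (Set.range (𝓡 n)) =ᶠ[𝓝 (extChartAt (𝓡 n) x x)]
      fun y => chartDeriv x ((extChartAt (𝓡 n) x).symm y) (Z ((extChartAt (𝓡 n) x).symm y)) := by
    intro Z
    filter_upwards [extChartAt_target_mem_nhds (I := 𝓡 n) x] with y hy
    have hs := symm_mem_source hy
    rw [VectorField.mpullbackWithin_apply, ModelWithCorners.range_eq_univ, mfderivWithin_univ,
      mfderiv_extChartAt_symm hy]
    have : (chartDerivInv x ((extChartAt (𝓡 n) x).symm y)).inverse =
        chartDeriv x ((extChartAt (𝓡 n) x).symm y) :=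
      ContinuousLinearMap.inverse_eq (ContinuousLinearMap.ext (chartDerivInv_chartDeriv hs))
        (ContinuousLinearMap.ext (chartDeriv_chartDerivInv hs))
    exact DFunLike.congr_fun this _
  have h := VectorField.mlieBracketWithin_apply (I := 𝓡 n) (V := X) (W := Y) (s := Set.univ)
    (x₀ := x)
  rw [VectorField.mlieBracketWithin_univ] at h
  rw [h]
  refine (chartDeriv_chartDerivInv (mem_chart_source _ x) _).trans ?_
  have hB : ∀ (A B : EuclideanSpace ℝ (Fin n) → EuclideanSpace ℝ (Fin n))
      (p : EuclideanSpace ℝ (Fin n)), VectorField.lieBracketWithin ℝ A B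
        ((extChartAt (𝓡 n) x).symm ⁻¹' Set.univ ∩ Set.range (𝓡 n)) p =
      VectorField.lieBracket ℝ A B p := by
    intro A B p
    rw [Set.preimage_univ, Set.univ_inter, ModelWithCorners.range_eq_univ,
      VectorField.lieBracketWithin_univ]
  exact (hB _ _ _).trans ((hpull X).lieBracket_vectorField_eq (hpull Y))

theorem dForm_apply (α : ∀ x : M, TangentSpace (𝓡 n) x →L[ℝ] ℝ) (u v : TangentSpace (𝓡 n) x) :
    dForm α x u v =
      fderiv ℝ (fun y => (α ((extChartAt (𝓡 n) x).symm y)).comp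
        (chartDerivInv x ((extChartAt (𝓡 n) x).symm y))) (extChartAt (𝓡 n) x x)
        (chartDeriv x x u) (chartDeriv x x v) -
      fderiv ℝ (fun y => (α ((extChartAt (𝓡 n) x).symm y)).comp
        (chartDerivInv x ((extChartAt (𝓡 n) x).symm y))) (extChartAt (𝓡 n) x x)
        (chartDeriv x x v) (chartDeriv x x u) := by
  have h : chartForm α x =ᶠ[𝓝 (extChartAt (𝓡 n) x x)]
      fun y => (α ((extChartAt (𝓡 n) x).symm y)).comp
        (chartDerivInv x ((extChartAt (𝓡 n) x).symm y)) := by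
    filter_upwards [extChartAt_target_mem_nhds (I := 𝓡 n) x] with y hy
    rw [chartForm, mfderiv_extChartAt_symm hy]
  rw [← h.fderiv_eq]
  rfl

theorem SmoothAt.differentiableAt {e : ∀ x : M, Fib n x} (he : SmoothAt e x) :
    DifferentiableAt ℝ (chartSec e x) (extChartAt (𝓡 n) x x) :=
  ((smoothAt_iff (mem_chart_source _ x)).1 he).differentiableAt (by simp)

theorem eventually_form_apply_field (e₁ e₂ : ∀ x : M, Fib n x) (x : M) :
    ∀ᶠ y in 𝓝 (extChartAt (𝓡 n) x x),
      (e₁ ((extChartAt (𝓡 n) x).symm y)).2.1 (e₂ ((extChartAt (𝓡 n) x).symm y)).1.1 =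
        (chartSec e₁ x y).2.1 (chartSec e₂ x y).1.1 := by
  filter_upwards [extChartAt_target_mem_nhds (I := 𝓡 n) x] with y hy
  exact congrArg _ (chartDerivInv_chartDeriv (symm_mem_source hy) _).symm

theorem SmoothAt.contMDiffAt_form_apply_field {e₁ e₂ : ∀ x : M, Fib n x} (h₁ : SmoothAt e₁ x)
    (h₂ : SmoothAt e₂ x) : ContMDiffAt (𝓡 n) 𝓘(ℝ, ℝ) ∞ (fun y => (e₁ y).2.1 (e₂ y).1.1) x := by
  rw [contMDiffAt_iff_chart (mem_chart_source _ x)]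
  have h₁' := (smoothAt_iff (mem_chart_source _ x)).1 h₁
  have h₂' := (smoothAt_iff (mem_chart_source _ x)).1 h₂
  exact (h₁'.snd.fst.clm_apply h₂'.fst.fst).congr_of_eventuallyEq
    (eventually_form_apply_field e₁ e₂ x)

theorem SmoothAt.lieForm_apply {e₁ e₂ : ∀ x : M, Fib n x} (h₁ : SmoothAt e₁ x)
    (h₂ : SmoothAt e₂ x) (v : TangentSpace (𝓡 n) x) :
    lieForm (fun y => (e₁ y).1.1) (fun y => (e₂ y).2.1) x v =
      flatLieForm (fun y => (chartSec e₁ x y).1.1) (fun y => (chartSec e₂ x y).2.1)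
        (extChartAt (𝓡 n) x x) (chartDeriv x x v) := by
  have h1 : chartDeriv x x (e₁ x).1.1 = (chartSec e₁ x (extChartAt (𝓡 n) x x)).1.1 := by
    rw [chartSec_apply e₁ (mem_chart_source _ x)]; rfl
  have h2 := mvfderiv_eq_fderiv (h₂.contMDiffAt_form_apply_field h₁)
    (eventually_form_apply_field e₂ e₁ x) v
  have h3 := dForm_apply (fun y => (e₂ y).2.1) (e₁ x).1.1 v
  rw [h1] at h3
  exact congrArg₂ (· + ·) h3 h2

/-- The chart is the one preferred at the point of evaluation, which is also the chart defining
`dForm`; chart independence of the exterior derivative is therefore never needed. -/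
theorem coord_bracket {e₁ e₂ : ∀ x : M, Fib n x} (h₁ : SmoothAt e₁ x) (h₂ : SmoothAt e₂ x) :
    coord x x (bracket e₁ e₂ x) =
      flatBracket (chartSec e₁ x) (chartSec e₂ x) (extChartAt (𝓡 n) x x) := by
  have hx := mem_chart_source (EuclideanSpace ℝ (Fin n)) x
  have hf₁ := mvfderiv_eq_fderiv (g := fun y => (chartSec e₁ x y).1.2) h₁.fst
    (Filter.Eventually.of_forall fun _ => rfl)
  have hf₂ := mvfderiv_eq_fderiv (g := fun y => (chartSec e₂ x y).1.2) h₂.fst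
    (Filter.Eventually.of_forall fun _ => rfl)
  have hg₁ := mvfderiv_eq_fderiv (g := fun y => (chartSec e₁ x y).2.2) h₁.snd
    (Filter.Eventually.of_forall fun _ => rfl)
  have hg₂ := mvfderiv_eq_fderiv (g := fun y => (chartSec e₂ x y).2.2) h₂.snd
    (Filter.Eventually.of_forall fun _ => rfl)
  have hd := mvfderiv_eq_fderiv (x := x) (h := fun y => (e₁ y).2.1 (e₂ y).1.1 - (e₂ y).2.1 (e₁ y).1.1)
    (g := fun y => (chartSec e₁ x y).2.1 (chartSec e₂ x y).1.1 -
      (chartSec e₂ x y).2.1 (chartSec e₁ x y).1.1)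
    ((h₁.contMDiffAt_form_apply_field h₂).sub (h₂.contMDiffAt_form_apply_field h₁))
    (((eventually_form_apply_field e₁ e₂ x).and (eventually_form_apply_field e₂ e₁ x)).mono
      fun y hy => congrArg₂ (· - ·) hy.1 hy.2)
  have hl₁ := h₁.lieForm_apply h₂
  have hl₂ := h₂.lieForm_apply h₁
  have hp := (eventually_form_apply_field e₁ e₂ x).self_of_nhds
  have hp' := (eventually_form_apply_field e₂ e₁ x).self_of_nhds
  rw [extChartAt_to_inv] at hp hp'
  have c₁ : chartSec e₁ x (extChartAt (𝓡 n) x x) = coord x x (e₁ x) := chartSec_apply e₁ hx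
  have c₂ : chartSec e₂ x (extChartAt (𝓡 n) x x) = coord x x (e₂ x) := chartSec_apply e₂ hx
  refine Prod.ext (Prod.ext ?_ ?_) (Prod.ext ?_ ?_)
  · refine (chartDeriv_mlieBracket _ _).trans ?_
    rfl
  · simp only [flatBracket]
    rw [c₁, c₂]
    exact congrArg₂ (· - ·) (hf₂ _) (hf₁ _)
  · refine ContinuousLinearMap.ext fun u => ?_
    have hu := chartDeriv_chartDerivInv hx u
    set v := chartDerivInv x x u
    change lieForm (fun y => (e₁ y).1.1) (fun y => (e₂ y).2.1) x v
        - lieForm (fun y => (e₂ y).1.1) (fun y => (e₁ y).2.1) x v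
        + (1 / 2 : ℝ) * mvfderiv (𝓡 n) (fun y => (e₁ y).2.1 (e₂ y).1.1 - (e₂ y).2.1 (e₁ y).1.1) x v
        + (e₁ x).1.2 * (e₂ x).2.1 v - (e₂ x).1.2 * (e₁ x).2.1 v
        + (1 / 2 : ℝ) * ((e₂ x).2.2 * mvfderiv (𝓡 n) (fun y => (e₁ y).1.2) x v
            - (e₁ x).2.2 * mvfderiv (𝓡 n) (fun y => (e₂ y).1.2) x v
            - (e₁ x).1.2 * mvfderiv (𝓡 n) (fun y => (e₂ y).2.2) x v
            + (e₂ x).1.2 * mvfderiv (𝓡 n) (fun y => (e₁ y).2.2) x v) = _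
    rw [hl₁ v, hl₂ v, hd v, hf₁ v, hf₂ v, hg₁ v, hg₂ v, hu]
    simp only [flatBracket]
    rw [c₁, c₂]
    rfl
  · change mvfderiv (𝓡 n) (fun y => (e₂ y).2.2) x (e₁ x).1.1
        - mvfderiv (𝓡 n) (fun y => (e₁ y).2.2) x (e₂ x).1.1
        + (1 / 2) * ((e₁ x).2.1 (e₂ x).1.1 - (e₂ x).2.1 (e₁ x).1.1
          - (e₂ x).1.2 * (e₁ x).2.2 + (e₁ x).1.2 * (e₂ x).2.2) = _
    rw [hg₁, hg₂, hp, hp']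
    simp only [flatBracket]
    rw [c₁, c₂]
    rfl

end BracketInCoordinates

/-! ### The immersion in charts, naturality of the bracket, local retractions -/

section SubmanifoldCoordinates

variable {n s : ℕ}
  {M : Type*} [TopologicalSpace M] [ChartedSpace (EuclideanSpace ℝ (Fin n)) M]
  {S : Type*} [TopologicalSpace S] [ChartedSpace (EuclideanSpace ℝ (Fin s)) S]

theorem eventually_extChartAt_symm {x₀ : M} {P : M → Prop} (h : ∀ᶠ x in 𝓝 x₀, P x) :
    ∀ᶠ y in 𝓝 (extChartAt (𝓡 n) x₀ x₀), P ((extChartAt (𝓡 n) x₀).symm y) := by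
  have h1 := continuousAt_extChartAt_symm (I := 𝓡 n) x₀
  rw [ContinuousAt, extChartAt_to_inv] at h1
  exact h1.eventually h

theorem eventually_extChartAt {x₀ : M} {P : EuclideanSpace ℝ (Fin n) → Prop}
    (h : ∀ᶠ y in 𝓝 (extChartAt (𝓡 n) x₀ x₀), P y) : ∀ᶠ x in 𝓝 x₀, P (extChartAt (𝓡 n) x₀ x) :=
  (continuousAt_extChartAt x₀).eventually h

theorem eventually_mem_chart_source (x₀ : M) :
    ∀ᶠ x in 𝓝 x₀, x ∈ (chartAt (EuclideanSpace ℝ (Fin n)) x₀).source :=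
  (chartAt (EuclideanSpace ℝ (Fin n)) x₀).open_source.mem_nhds (mem_chart_source _ x₀)

/-- A map between manifolds read in the preferred charts at `x₀` and at the image of `x₀`. -/
def chartMap (n s : ℕ) [ChartedSpace (EuclideanSpace ℝ (Fin n)) M]
    [ChartedSpace (EuclideanSpace ℝ (Fin s)) S] (j : S → M) (x₀ : S)
    (z : EuclideanSpace ℝ (Fin s)) : EuclideanSpace ℝ (Fin n) :=
  extChartAt (𝓡 n) (j x₀) (j ((extChartAt (𝓡 s) x₀).symm z))

variable {j : S → M} {x₀ x : S}

theorem chartMap_apply (hx : x ∈ (chartAt (EuclideanSpace ℝ (Fin s)) x₀).source) :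
    chartMap n s j x₀ (extChartAt (𝓡 s) x₀ x) = extChartAt (𝓡 n) (j x₀) (j x) := by
  rw [chartMap, (extChartAt (𝓡 s) x₀).left_inv (by rwa [extChartAt_source])]

theorem eventually_mem_chart_sources (hj : Continuous j) (x₀ : S) :
    ∀ᶠ x in 𝓝 x₀, x ∈ (chartAt (EuclideanSpace ℝ (Fin s)) x₀).source ∧
      j x ∈ (chartAt (EuclideanSpace ℝ (Fin n)) (j x₀)).source :=
  (eventually_mem_chart_source x₀).and
    (hj.continuousAt.eventually (eventually_mem_chart_source (j x₀)))

variable [IsManifold (𝓡 n) ∞ M] [IsManifold (𝓡 s) ∞ S]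

theorem contDiffAt_chartMap (hj : ContMDiff (𝓡 s) (𝓡 n) ∞ j)
    (hx : x ∈ (chartAt (EuclideanSpace ℝ (Fin s)) x₀).source)
    (hjx : j x ∈ (chartAt (EuclideanSpace ℝ (Fin n)) (j x₀)).source) :
    ContDiffAt ℝ ∞ (chartMap n s j x₀) (extChartAt (𝓡 s) x₀ x) := by
  have h : ContMDiffAt (𝓡 s) 𝓘(ℝ, EuclideanSpace ℝ (Fin n)) ∞
      (fun x => extChartAt (𝓡 n) (j x₀) (j x)) x :=
    ContMDiffAt.comp x (contMDiffAt_extChartAt' hjx) hj.contMDiffAt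
  exact (contMDiffAt_iff_chart hx).1 h

theorem fderiv_chartMap (hj : ContMDiff (𝓡 s) (𝓡 n) ∞ j)
    (hx : x ∈ (chartAt (EuclideanSpace ℝ (Fin s)) x₀).source)
    (hjx : j x ∈ (chartAt (EuclideanSpace ℝ (Fin n)) (j x₀)).source)
    (v : TangentSpace (𝓡 s) x) :
    fderiv ℝ (chartMap n s j x₀) (extChartAt (𝓡 s) x₀ x) (chartDeriv x₀ x v) =
      chartDeriv (j x₀) (j x) (mfderiv (𝓡 s) (𝓡 n) j x v) := by
  have h : (chartMap n s j x₀) ∘ (extChartAt (𝓡 s) x₀) =ᶠ[𝓝 x] (extChartAt (𝓡 n) (j x₀)) ∘ j := by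
    filter_upwards [(chartAt (EuclideanSpace ℝ (Fin s)) x₀).open_source.mem_nhds hx] with z hz
    exact chartMap_apply hz
  have hjd : MDifferentiableAt (𝓡 s) (𝓡 n) j x := hj.mdifferentiableAt (by simp)
  have hM : MDifferentiableAt (𝓡 n) 𝓘(ℝ, EuclideanSpace ℝ (Fin n)) (extChartAt (𝓡 n) (j x₀)) (j x) :=
    mdifferentiableAt_extChartAt hjx
  have hS : MDifferentiableAt (𝓡 s) 𝓘(ℝ, EuclideanSpace ℝ (Fin s)) (extChartAt (𝓡 s) x₀) x :=
    mdifferentiableAt_extChartAt hx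
  have hc : DifferentiableAt ℝ (chartMap n s j x₀) (extChartAt (𝓡 s) x₀ x) :=
    (contDiffAt_chartMap hj hx hjx).differentiableAt (by simp)
  have h1 := h.mfderiv_eq (I := 𝓡 s) (I' := 𝓘(ℝ, EuclideanSpace ℝ (Fin n)))
  rw [mfderiv_comp x hM hjd, mfderiv_comp x hc.mdifferentiableAt hS, mfderiv_eq_fderiv] at h1
  exact DFunLike.congr_fun h1 v

theorem rel_iff_rel_coord (hj : ContMDiff (𝓡 s) (𝓡 n) ∞ j)
    (hx : x ∈ (chartAt (EuclideanSpace ℝ (Fin s)) x₀).source)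
    (hjx : j x ∈ (chartAt (EuclideanSpace ℝ (Fin n)) (j x₀)).source)
    (a : Fib n (j x)) (q : Fib s x) :
    Rel (mfderiv (𝓡 s) (𝓡 n) j x) a q ↔
      Rel (fderiv ℝ (chartMap n s j x₀) (extChartAt (𝓡 s) x₀ x)) (coord (j x₀) (j x) a)
        (coord x₀ x q) := by
  have hD := fderiv_chartMap hj hx hjx
  have h1 : a.1.1 = mfderiv (𝓡 s) (𝓡 n) j x q.1.1 ↔ chartDeriv (j x₀) (j x) a.1.1 =
      fderiv ℝ (chartMap n s j x₀) (extChartAt (𝓡 s) x₀ x) (chartDeriv x₀ x q.1.1) := by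
    rw [hD]
    exact ((Function.LeftInverse.injective (chartDerivInv_chartDeriv hjx)).eq_iff).symm
  have h2 : a.2.1.comp (mfderiv (𝓡 s) (𝓡 n) j x) = q.2.1 ↔
      (a.2.1.comp (chartDerivInv (j x₀) (j x))).comp
        (fderiv ℝ (chartMap n s j x₀) (extChartAt (𝓡 s) x₀ x)) =
      q.2.1.comp (chartDerivInv x₀ x) := by
    constructor
    · intro h
      refine ContinuousLinearMap.ext fun u => ?_
      have h3 := hD (chartDerivInv x₀ x u)
      rw [chartDeriv_chartDerivInv hx] at h3
      change a.2.1 (chartDerivInv (j x₀) (j x) (fderiv ℝ (chartMap n s j x₀)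
        (extChartAt (𝓡 s) x₀ x) u)) = q.2.1 (chartDerivInv x₀ x u)
      rw [h3, chartDerivInv_chartDeriv hjx, ← h]
      rfl
    · intro h
      refine ContinuousLinearMap.ext fun v => ?_
      have h3 : a.2.1 (chartDerivInv (j x₀) (j x) (fderiv ℝ (chartMap n s j x₀)
          (extChartAt (𝓡 s) x₀ x) (chartDeriv x₀ x v))) =
          q.2.1 (chartDerivInv x₀ x (chartDeriv x₀ x v)) :=
        DFunLike.congr_fun h (chartDeriv x₀ x v)
      rw [hD, chartDerivInv_chartDeriv hjx, chartDerivInv_chartDeriv hx] at h3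
      exact h3
  exact and_congr h1 (and_congr Iff.rfl (and_congr h2 Iff.rfl))

theorem eventually_contDiffAt_chartMap (hj : ContMDiff (𝓡 s) (𝓡 n) ∞ j) (x₀ : S) :
    ∀ᶠ z in 𝓝 (extChartAt (𝓡 s) x₀ x₀), ContDiffAt ℝ ∞ (chartMap n s j x₀) z := by
  filter_upwards [eventually_extChartAt_symm (eventually_mem_chart_sources (n := n) (s := s)
    hj.continuous x₀), extChartAt_target_mem_nhds (I := 𝓡 s) x₀] with z hz hz'
  have := contDiffAt_chartMap hj hz.1 hz.2
  rwa [(extChartAt (𝓡 s) x₀).right_inv hz'] at this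

theorem eventually_rel_chartSec (hj : ContMDiff (𝓡 s) (𝓡 n) ∞ j) {e : ∀ y : M, Fib n y}
    {ε : ∀ x : S, Fib s x} (h : ∀ᶠ x in 𝓝 x₀, Rel (mfderiv (𝓡 s) (𝓡 n) j x) (e (j x)) (ε x)) :
    ∀ᶠ z in 𝓝 (extChartAt (𝓡 s) x₀ x₀), Rel (fderiv ℝ (chartMap n s j x₀) z)
      (chartSec e (j x₀) (chartMap n s j x₀ z)) (chartSec ε x₀ z) := by
  filter_upwards [eventually_extChartAt_symm (h.and (eventually_mem_chart_sources (n := n) (s := s)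
    hj.continuous x₀)), extChartAt_target_mem_nhds (I := 𝓡 s) x₀] with z hz hz'
  have h1 := (rel_iff_rel_coord hj hz.2.1 hz.2.2 _ _).1 hz.1
  rw [(extChartAt (𝓡 s) x₀).right_inv hz', ← chartSec_apply e hz.2.2] at h1
  exact h1

/-- The bracket of sections of `𝓔¹(M)` is natural under immersions. -/
theorem rel_bracket (hj : ContMDiff (𝓡 s) (𝓡 n) ∞ j) {e₁ e₂ : ∀ y : M, Fib n y}
    {ε₁ ε₂ : ∀ x : S, Fib s x} (he₁ : SmoothAt e₁ (j x₀)) (he₂ : SmoothAt e₂ (j x₀))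
    (hε₁ : SmoothAt ε₁ x₀) (hε₂ : SmoothAt ε₂ x₀)
    (h₁ : ∀ᶠ x in 𝓝 x₀, Rel (mfderiv (𝓡 s) (𝓡 n) j x) (e₁ (j x)) (ε₁ x))
    (h₂ : ∀ᶠ x in 𝓝 x₀, Rel (mfderiv (𝓡 s) (𝓡 n) j x) (e₂ (j x)) (ε₂ x)) :
    Rel (mfderiv (𝓡 s) (𝓡 n) j x₀) (bracket e₁ e₂ (j x₀)) (bracket ε₁ ε₂ x₀) := by
  have hx := mem_chart_source (EuclideanSpace ℝ (Fin s)) x₀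
  have hjx := mem_chart_source (EuclideanSpace ℝ (Fin n)) (j x₀)
  rw [rel_iff_rel_coord hj hx hjx, coord_bracket he₁ he₂, coord_bracket hε₁ hε₂,
    ← chartMap_apply hx]
  refine rel_flatBracket (contDiffAt_chartMap hj hx hjx) ?_ ?_ hε₁.differentiableAt
    hε₂.differentiableAt (eventually_rel_chartSec hj h₁) (eventually_rel_chartSec hj h₂)
  · rw [chartMap_apply hx]; exact he₁.differentiableAt
  · rw [chartMap_apply hx]; exact he₂.differentiableAt

/-- An immersion, read in charts, has a smooth local left inverse. -/
theorem exists_local_retraction {U V : Type*} [NormedAddCommGroup U] [NormedSpace ℝ U]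
    [CompleteSpace U] [FiniteDimensional ℝ U] [NormedAddCommGroup V] [NormedSpace ℝ V]
    [FiniteDimensional ℝ V] {f : U → V} {p : U}
    (hf : ∀ᶠ z in 𝓝 p, ContDiffAt ℝ ∞ f z) (hinj : Function.Injective (fderiv ℝ f p)) :
    ∃ r : V → U, (∀ᶠ y in 𝓝 (f p), ContDiffAt ℝ ∞ r y) ∧ ∀ᶠ z in 𝓝 p, r (f z) = z := by
  obtain ⟨P₀, hP₀⟩ := (fderiv ℝ f p).toLinearMap.exists_leftInverse_of_injective
    (LinearMap.ker_eq_bot.2 hinj)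
  let P : V →L[ℝ] U := LinearMap.toContinuousLinearMap P₀
  have hg : ∀ᶠ z in 𝓝 p, ContDiffAt ℝ ∞ (fun z => P (f z)) z :=
    hf.mono fun z hz => P.contDiff.contDiffAt.comp z hz
  set g : U → U := fun z => P (f z)
  have hgp : fderiv ℝ g p = 1 := by
    have h1 : fderiv ℝ g p = P.comp (fderiv ℝ f p) :=
      (P.hasFDerivAt.comp p (hf.self_of_nhds.differentiableAt (by simp)).hasFDerivAt).fderiv
    rw [h1]
    exact ContinuousLinearMap.ext fun u => LinearMap.congr_fun hP₀ u
  have hstrict : HasStrictFDerivAt g ((ContinuousLinearEquiv.refl ℝ U : U ≃L[ℝ] U) : U →L[ℝ] U) p := by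
    have := hg.self_of_nhds.hasStrictFDerivAt (by simp)
    rwa [hgp] at this
  -- Invertibility of the derivative near `p`, not only at `p`, makes the local inverse smooth on a
  -- whole neighbourhood.
  have hunit : ∀ᶠ z in 𝓝 p, IsUnit (fderiv ℝ g z) := by
    have h1 : ContinuousAt (fderiv ℝ g) p :=
      (hg.self_of_nhds.fderiv_right (m := ∞) (by simp)).continuousAt
    refine h1.eventually (Units.isOpen.mem_nhds ?_)
    rw [hgp]; exact isUnit_one
  let G := hstrict.toOpenPartialHomeomorph g
  have hG : ∀ z, G z = g z := fun z => rfl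
  have hpG : p ∈ G.source := hstrict.mem_toOpenPartialHomeomorph_source
  have hsymm : ∀ᶠ a in 𝓝 (g p), ContDiffAt ℝ ∞ G.symm a := by
    have h1 : Filter.Tendsto G.symm (𝓝 (g p)) (𝓝 p) := by
      have := G.continuousAt_symm (G.map_source hpG)
      rwa [ContinuousAt, G.left_inv hpG] at this
    filter_upwards [G.open_target.mem_nhds (G.map_source hpG), h1.eventually (hg.and hunit)]
      with a ha hb
    obtain ⟨u, hu⟩ := hb.2
    refine G.contDiffAt_symm (f₀' := ContinuousLinearEquiv.unitsEquiv ℝ U u) ha ?_ hb.1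
    have := (hb.1.differentiableAt (by simp)).hasFDerivAt
    rw [← hu] at this
    exact this
  refine ⟨fun y => G.symm (P y), ?_, ?_⟩
  · have h1 : ContinuousAt P (f p) := P.continuous.continuousAt
    filter_upwards [h1.eventually hsymm] with y hy
    exact hy.comp y P.contDiff.contDiffAt
  · filter_upwards [G.open_source.mem_nhds hpG] with z hz
    exact G.left_inv hz

end SubmanifoldCoordinates

/-! ### Relatedness as a linear equation -/

section SplitRel

variable {U V W : Type*} [NormedAddCommGroup U] [NormedSpace ℝ U]
  [NormedAddCommGroup V] [NormedSpace ℝ V] [NormedAddCommGroup W] [NormedSpace ℝ W]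

/-- For a left inverse `R` of `D`, the linear map whose value at `a` is `(0, q)` if and only if
`a` and `q` are related by `D`. -/
def splitRel (D : U →L[ℝ] V) (R : V →L[ℝ] U) :
    ((V × ℝ) × ((V →L[ℝ] ℝ) × ℝ)) →ₗ[ℝ] V × ((U × ℝ) × ((U →L[ℝ] ℝ) × ℝ)) where
  toFun a := (a.1.1 - D (R a.1.1), ((R a.1.1, a.1.2), (a.2.1.comp D, a.2.2)))
  map_add' a b := by
    refine Prod.ext ?_ (Prod.ext (Prod.ext (map_add R _ _) rfl) (Prod.ext ?_ rfl))
    · simp only [Prod.fst_add, map_add]; abel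
    · exact ContinuousLinearMap.ext fun _ => rfl
  map_smul' c a := by
    refine Prod.ext ?_ (Prod.ext (Prod.ext (map_smul R _ _) rfl) (Prod.ext ?_ rfl))
    · simp [smul_sub]
    · exact ContinuousLinearMap.ext fun _ => rfl

theorem splitRel_eq_iff {D : U →L[ℝ] V} {R : V →L[ℝ] U} (h : ∀ u, R (D u) = u)
    (a : (V × ℝ) × ((V →L[ℝ] ℝ) × ℝ)) (q : (U × ℝ) × ((U →L[ℝ] ℝ) × ℝ)) :
    splitRel D R a = (0, q) ↔ Rel D a q := by
  constructor
  · intro hq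
    have h1 : a.1.1 - D (R a.1.1) = 0 := congrArg Prod.fst hq
    have h2 : ((R a.1.1, a.1.2), (a.2.1.comp D, a.2.2)) = q := congrArg Prod.snd hq
    rw [← h2]
    exact ⟨sub_eq_zero.1 h1, rfl, rfl, rfl⟩
  · rintro ⟨h1, h2, h3, h4⟩
    have h5 : R a.1.1 = q.1.1 := by rw [h1, h]
    refine Prod.ext ?_ (Prod.ext (Prod.ext h5 h2) (Prod.ext h3 h4))
    change a.1.1 - D (R a.1.1) = 0
    rw [h5, h1, sub_self]

theorem contDiffAt_splitRel {D : W → U →L[ℝ] V} {R : W → V →L[ℝ] U}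
    {a : W → (V × ℝ) × ((V →L[ℝ] ℝ) × ℝ)} {z : W} (hD : ContDiffAt ℝ ∞ D z)
    (hR : ContDiffAt ℝ ∞ R z) (ha : ContDiffAt ℝ ∞ a z) :
    ContDiffAt ℝ ∞ (fun z => splitRel (D z) (R z) (a z)) z :=
  (ha.fst.fst.sub (hD.clm_apply (hR.clm_apply ha.fst.fst))).prodMk
    (((hR.clm_apply ha.fst.fst).prodMk ha.fst.snd).prodMk ((ha.snd.fst.clm_comp hD).prodMk
      ha.snd.snd))

/-- The linear map `c ↦ ∑ i, c i • w i`. -/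
def linComb {k : ℕ} (w : Fin k → V) : (Fin k → ℝ) →L[ℝ] V :=
  ∑ i, (ContinuousLinearMap.proj (R := ℝ) (φ := fun _ : Fin k => ℝ) i).smulRight (w i)

theorem linComb_apply {k : ℕ} (w : Fin k → V) (c : Fin k → ℝ) :
    linComb w c = ∑ i, c i • w i := by
  simp [linComb]

theorem contDiffAt_linComb {k : ℕ} {w : Fin k → W → V} {z : W}
    (hw : ∀ i, ContDiffAt ℝ ∞ (w i) z) : ContDiffAt ℝ ∞ (fun z => linComb fun i => w i z) z :=
  ContDiffAt.sum fun i _ => contDiffAt_const.smulRight (hw i)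

open Module in
theorem finrank_comap_linearCombination {V : Type*} [AddCommGroup V] [Module ℝ V]
    {k : ℕ} {w : Fin k → V} (hw : LinearIndependent ℝ w) {N : Submodule ℝ V}
    (hN : N ≤ Submodule.span ℝ (Set.range w)) :
    finrank ℝ (N.comap (Fintype.linearCombination ℝ w)) = finrank ℝ N := by
  have hinj : Function.Injective (Fintype.linearCombination ℝ w) :=
    hw.fintypeLinearCombination_injective
  rw [(Submodule.equivMapOfInjective _ hinj _).finrank_eq, Submodule.map_comap_eq,
    Fintype.range_linearCombination, inf_eq_right.2 hN]

end SplitRel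

/-! ### The equation for frame coefficients -/

section Lifting

open Module

variable {n s k : ℕ}
  {M : Type*} [TopologicalSpace M] [ChartedSpace (EuclideanSpace ℝ (Fin n)) M]
  {S : Type*} [TopologicalSpace S] [ChartedSpace (EuclideanSpace ℝ (Fin s)) S]
  {j : S → M} {x₀ : S}

theorem eventually_chart {x₀ : S} {P : S → EuclideanSpace ℝ (Fin s) → Prop}
    (h : ∀ᶠ x in 𝓝 x₀, P x (extChartAt (𝓡 s) x₀ x)) :
    ∀ᶠ z in 𝓝 (extChartAt (𝓡 s) x₀ x₀), P ((extChartAt (𝓡 s) x₀).symm z) z := by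
  filter_upwards [eventually_extChartAt_symm h, extChartAt_target_mem_nhds (I := 𝓡 s) x₀]
    with z hz hz'
  rwa [(extChartAt (𝓡 s) x₀).right_inv hz'] at hz

variable [IsManifold (𝓡 n) ∞ M] [IsManifold (𝓡 s) ∞ S]

theorem exists_chart_retraction (hj : ContMDiff (𝓡 s) (𝓡 n) ∞ j)
    (hinj : Function.Injective (mfderiv (𝓡 s) (𝓡 n) j x₀)) :
    ∃ r : EuclideanSpace ℝ (Fin n) → EuclideanSpace ℝ (Fin s),
      (∀ᶠ y in 𝓝 (chartMap n s j x₀ (extChartAt (𝓡 s) x₀ x₀)), ContDiffAt ℝ ∞ r y) ∧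
      ∀ᶠ z in 𝓝 (extChartAt (𝓡 s) x₀ x₀), r (chartMap n s j x₀ z) = z := by
  have hx := mem_chart_source (EuclideanSpace ℝ (Fin s)) x₀
  have hjx := mem_chart_source (EuclideanSpace ℝ (Fin n)) (j x₀)
  refine exists_local_retraction (eventually_contDiffAt_chartMap hj x₀) fun u v huv => ?_
  rw [← chartDeriv_chartDerivInv hx u, ← chartDeriv_chartDerivInv hx v,
    fderiv_chartMap hj hx hjx, fderiv_chartMap hj hx hjx] at huv
  have h1 := hinj (Function.LeftInverse.injective (chartDerivInv_chartDeriv hjx) huv)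
  rw [← chartDeriv_chartDerivInv hx u, h1, chartDeriv_chartDerivInv hx]

/-- The map `G z` applies `splitRel` to the combination of the frame with coefficients `c`. Its
first component tests tangency to `S`, and its second reads off the restricted element, so all
unknowns live in the fixed space `Fin k → ℝ`. -/
theorem exists_chart_equation (hj : ContMDiff (𝓡 s) (𝓡 n) ∞ j)
    (hinj : Function.Injective (mfderiv (𝓡 s) (𝓡 n) j x₀)) {e : Fin k → ∀ y : M, Fib n y}
    (he : ∀ i, ∀ᶠ y in 𝓝 (j x₀), SmoothAt (e i) y) :
    ∃ G : EuclideanSpace ℝ (Fin s) → (Fin k → ℝ) →L[ℝ] EuclideanSpace ℝ (Fin n) × ModelFib s,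
      (∀ᶠ z in 𝓝 (extChartAt (𝓡 s) x₀ x₀), ContDiffAt ℝ ∞ G z) ∧
      ∀ᶠ x in 𝓝 x₀, ∀ (c : Fin k → ℝ) (q : Fib s x),
        G (extChartAt (𝓡 s) x₀ x) c = (0, coord x₀ x q) ↔
          Rel (mfderiv (𝓡 s) (𝓡 n) j x) (∑ i, c i • e i (j x)) q := by
  have hx := mem_chart_source (EuclideanSpace ℝ (Fin s)) x₀
  set p := extChartAt (𝓡 s) x₀ x₀ with hp
  have hJ := eventually_contDiffAt_chartMap hj x₀
  have hJp : chartMap n s j x₀ p = extChartAt (𝓡 n) (j x₀) (j x₀) := chartMap_apply hx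
  have hJc : ContinuousAt (chartMap n s j x₀) p := hJ.self_of_nhds.continuousAt
  obtain ⟨r, hr, hrJ⟩ := exists_chart_retraction hj hinj
  -- The identity `r ∘ chartMap = id` holds on a neighbourhood, so it can be differentiated at every
  -- nearby point; `fderiv ℝ r` thus supplies a smooth family of left inverses for `splitRel`.
  have hRD : ∀ᶠ z in 𝓝 p, ∀ u,
      fderiv ℝ r (chartMap n s j x₀ z) (fderiv ℝ (chartMap n s j x₀) z u) = u := by
    filter_upwards [hrJ.eventually_nhds, hJ, hJc.eventually hr] with z h1 h2 h3 u
    have h4 : (fun z => r (chartMap n s j x₀ z)) =ᶠ[𝓝 z] id := h1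
    have h5 := h4.fderiv_eq (𝕜 := ℝ)
    rw [fderiv_id] at h5
    have h6 := fderiv_comp z (h3.differentiableAt (by simp)) (h2.differentiableAt (by simp))
    exact (DFunLike.congr_fun (h6.symm.trans h5) u)
  have hE : ∀ᶠ z in 𝓝 p, ∀ i, ContDiffAt ℝ ∞ (chartSec (e i) (j x₀)) (chartMap n s j x₀ z) := by
    refine Filter.eventually_all.2 fun i => hJc.eventually ?_
    rw [hJp]
    exact eventually_smoothAt_iff.1 (he i)
  refine ⟨fun z => linComb fun i => splitRel (fderiv ℝ (chartMap n s j x₀) z)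
    (fderiv ℝ r (chartMap n s j x₀ z)) (chartSec (e i) (j x₀) (chartMap n s j x₀ z)), ?_, ?_⟩
  · filter_upwards [hJ, hJc.eventually hr, hE] with z h1 h2 h3
    exact contDiffAt_linComb fun i => contDiffAt_splitRel (h1.fderiv_right (m := ∞) (by simp))
      ((h2.fderiv_right (m := ∞) (by simp)).comp z h1) ((h3 i).comp z h1)
  · filter_upwards [eventually_mem_chart_sources (n := n) (s := s) hj.continuous x₀,
      eventually_extChartAt hRD] with x h1 h2 c q
    have h3 : coord (j x₀) (j x) (∑ i, c i • e i (j x)) =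
        ∑ i, c i • chartSec (e i) (j x₀) (chartMap n s j x₀ (extChartAt (𝓡 s) x₀ x)) := by
      rw [map_sum]
      refine Finset.sum_congr rfl fun i _ => ?_
      rw [map_smul, chartMap_apply h1.1, chartSec_apply _ h1.2]
    rw [rel_iff_rel_coord hj h1.1 h1.2, h3, ← splitRel_eq_iff h2, linComb_apply, map_sum]
    simp only [map_smul]

end Lifting

/-! ### Extending local sections by bump functions -/

section Extension

variable {n k : ℕ}
  {M : Type*} [TopologicalSpace M] [ChartedSpace (EuclideanSpace ℝ (Fin n)) M]
  [IsManifold (𝓡 n) ∞ M] {y₀ y : M}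

theorem SmoothAt.congr {e e' : ∀ y : M, Fib n y} (he : SmoothAt e y)
    (h : ∀ᶠ z in 𝓝 y, e' z = e z) : SmoothAt e' y := by
  rw [smoothAt_iff (mem_chart_source _ y)] at he ⊢
  refine he.congr_of_eventuallyEq ?_
  filter_upwards [eventually_extChartAt_symm h] with z hz
  rw [chartSec, chartSec, hz]

theorem SmoothAt.smul {e : ∀ y : M, Fib n y} (he : SmoothAt e y) {ρ : M → ℝ}
    (hρ : ContMDiffAt (𝓡 n) 𝓘(ℝ, ℝ) ∞ ρ y) : SmoothAt (fun z => ρ z • e z) y := by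
  rw [smoothAt_iff (mem_chart_source _ y)] at he ⊢
  refine (((contMDiffAt_iff_chart (mem_chart_source _ y)).1 hρ).smul he).congr_of_eventuallyEq ?_
  exact Filter.Eventually.of_forall fun z => map_smul (coord y _) _ _

theorem smoothAt_zero : SmoothAt (fun y : M => (0 : Fib n y)) y := by
  rw [smoothAt_iff (mem_chart_source _ y)]
  have h : chartSec (fun y : M => (0 : Fib n y)) y = fun _ => 0 :=
    funext fun z => map_zero (coord y _)
  rw [h]
  exact contDiffAt_const

/-- Closure under the bracket is known only for global sections, so local ones must be globalised.
Multiplication by a bump function keeps the values in `L` and leaves the germ at `y₀` unchanged. -/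
theorem exists_global_extension [T2Space M] {L : ∀ y : M, Submodule ℝ (Fib n y)}
    {e : ∀ y : M, Fib n y} (he : ∀ᶠ y in 𝓝 y₀, SmoothAt e y) (hL : ∀ᶠ y in 𝓝 y₀, e y ∈ L y) :
    ∃ e' : ∀ y : M, Fib n y, SmoothOn e' Set.univ ∧ (∀ y, e' y ∈ L y) ∧
      ∀ᶠ y in 𝓝 y₀, e' y = e y := by
  obtain ⟨ρ, -, hρ⟩ := (SmoothBumpFunction.nhds_basis_tsupport (I := 𝓡 n) y₀).mem_iff.1 (he.and hL)
  refine ⟨fun y => ρ y • e y, smoothOn_of_smoothAt fun y _ => ?_, fun y => ?_, ?_⟩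
  · by_cases hy : y ∈ tsupport ρ
    · exact (hρ hy).1.smul ρ.contMDiffAt
    · refine smoothAt_zero.congr ?_
      filter_upwards [(isClosed_tsupport ρ).isOpen_compl.mem_nhds hy] with z hz
      rw [image_eq_zero_of_notMem_tsupport hz, zero_smul]
  · by_cases hy : y ∈ tsupport ρ
    · exact (L y).smul_mem _ (hρ hy).2
    · beta_reduce
      rw [image_eq_zero_of_notMem_tsupport hy, zero_smul]
      exact (L y).zero_mem
  · filter_upwards [ρ.eventuallyEq_one] with y hy
    rw [hy, Pi.one_apply, one_smul]

end Extension

/-! ### Smooth lifts and smooth local sections of `L_S` -/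

section Induced

open Module

variable {n s k : ℕ}
  {M : Type*} [TopologicalSpace M] [ChartedSpace (EuclideanSpace ℝ (Fin n)) M]
  {S : Type*} [TopologicalSpace S] [ChartedSpace (EuclideanSpace ℝ (Fin s)) S]
  {L : ∀ y : M, Submodule ℝ (Fib n y)} {j : S → M} {x₀ : S}

theorem sum_smul_mem_span {V : Type*} [AddCommGroup V] [Module ℝ V] (w : Fin k → V)
    (c : Fin k → ℝ) : ∑ i, c i • w i ∈ Submodule.span ℝ (Set.range w) :=
  Submodule.sum_mem _ fun i _ => Submodule.smul_mem _ _ (Submodule.subset_span ⟨i, rfl⟩)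

theorem mem_hat_iff {y : M} {x : S} {W : Submodule ℝ (Fib n y)}
    {D : TangentSpace (𝓡 s) x →L[ℝ] TangentSpace (𝓡 n) y} {a : Fib n y} :
    a ∈ hat W D ↔ a ∈ W ∧ ∃ q : Fib s x, Rel D a q := by
  constructor
  · rintro ⟨h, ⟨⟨u, hu⟩, -⟩, -⟩
    exact ⟨h, ((u, a.1.2), (a.2.1.comp D, a.2.2)), hu.symm, rfl, rfl, rfl⟩
  · rintro ⟨h, q, hq⟩
    exact ⟨h, ⟨⟨q.1.1, hq.1.symm⟩, trivial⟩, trivial⟩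

theorem mem_conormal_iff {y : M} {x : S} {W : Submodule ℝ (Fib n y)}
    {D : TangentSpace (𝓡 s) x →L[ℝ] TangentSpace (𝓡 n) y} {a : Fib n y} :
    a ∈ conormal W D ↔ a ∈ W ∧ Rel D a (0 : Fib s x) := by
  constructor
  · rintro ⟨h, h1, h2, h3⟩
    have h1 : a.1 = 0 := h1
    refine ⟨h, (congrArg Prod.fst h1).trans (map_zero D).symm, congrArg Prod.snd h1, ?_, h3⟩
    exact ContinuousLinearMap.ext fun u => h2 u
  · rintro ⟨h, h1, h2, h3, h4⟩
    exact ⟨h, Prod.ext (h1.trans (map_zero D)) h2, fun u => DFunLike.congr_fun h3 u, h4⟩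

variable [IsManifold (𝓡 n) ∞ M] [IsManifold (𝓡 s) ∞ S]

theorem mem_induced_iff_rel (hj : Manifold.IsImmersion (𝓡 s) (𝓡 n) ∞ j) {x : S} {q : Fib s x} :
    q ∈ induced L hj x ↔ ∃ a ∈ L (j x), Rel (mfderiv (𝓡 s) (𝓡 n) j x) a q := by
  rw [mem_induced]
  constructor
  · rintro ⟨α, h1, h2⟩
    exact ⟨_, h2, rfl, rfl, h1, rfl⟩
  · rintro ⟨⟨⟨X, f⟩, ⟨α, g⟩⟩, h, h1, h2, h3, h4⟩
    have h1 : X = _ := h1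
    have h2 : f = _ := h2
    have h4 : g = _ := h4
    subst h1 h2 h4
    exact ⟨α, h3, h⟩

variable (hj : Manifold.IsImmersion (𝓡 s) (𝓡 n) ∞ j)
  {e : Fin k → ∀ y : M, Fib n y} {V : Set M}

/-- A pointwise lift exists because `ε` takes values in `L_S`, and lifts differ by conormal
elements. The constant dimension of `conormal` is thus the rank condition for choosing the lift
smoothly. -/
theorem exists_smooth_lift (hV : IsOpen V) (hx₀ : j x₀ ∈ V) (he : ∀ i, SmoothOn (e i) V)
    (hfr : ∀ y ∈ V, LinearIndependent ℝ (fun i => e i y) ∧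
      Submodule.span ℝ (Set.range fun i => e i y) = L y)
    {r : ℕ} (hrank : ∀ x, finrank ℝ (conormal (L (j x)) (mfderiv (𝓡 s) (𝓡 n) j x)) = r)
    {ε : ∀ x : S, Fib s x} (hε : ∀ᶠ x in 𝓝 x₀, SmoothAt ε x)
    (hmem : ∀ᶠ x in 𝓝 x₀, ε x ∈ induced L hj x) :
    ∃ c : EuclideanSpace ℝ (Fin s) → Fin k → ℝ,
      (∀ᶠ z in 𝓝 (extChartAt (𝓡 s) x₀ x₀), ContDiffAt ℝ ∞ c z) ∧
      ∀ᶠ x in 𝓝 x₀, Rel (mfderiv (𝓡 s) (𝓡 n) j x)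
        (∑ i, c (extChartAt (𝓡 s) x₀ x) i • e i (j x)) (ε x) := by
  have hVy : ∀ᶠ y in 𝓝 (j x₀), y ∈ V := hV.mem_nhds hx₀
  have hVx : ∀ᶠ x in 𝓝 x₀, j x ∈ V := hj.contMDiff.continuous.continuousAt.eventually hVy
  obtain ⟨G, hG, hrel⟩ := exists_chart_equation hj.contMDiff
    (mfderiv_injective_of_isImmersion hj x₀) (e := e)
    fun i => hVy.mono fun y hy => (he i).smoothAt hV hy
  have hsol : ∀ᶠ x in 𝓝 x₀, ∃ d, G (extChartAt (𝓡 s) x₀ x) d =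
      (0, chartSec ε x₀ (extChartAt (𝓡 s) x₀ x)) := by
    filter_upwards [hrel, hVx, hmem, eventually_mem_chart_source (n := s) x₀] with x h1 h2 h3 h4
    obtain ⟨a, ha, hrel⟩ := (mem_induced_iff_rel hj).1 h3
    rw [← (hfr _ h2).2, Submodule.mem_span_range_iff_exists_fun] at ha
    obtain ⟨d, rfl⟩ := ha
    refine ⟨d, ?_⟩
    rw [chartSec_apply ε h4]
    exact (h1 d _).2 hrel
  have hker : ∀ᶠ x in 𝓝 x₀,
      finrank ℝ (LinearMap.ker (G (extChartAt (𝓡 s) x₀ x)).toLinearMap) = r := by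
    filter_upwards [hrel, hVx] with x h1 h2
    rw [← hrank x, ← finrank_comap_linearCombination (hfr _ h2).1
      (by rw [(hfr _ h2).2]; exact inf_le_left)]
    refine congrArg (fun K : Submodule ℝ (Fin k → ℝ) => finrank ℝ K) (Submodule.ext fun c => ?_)
    have h3 := h1 c 0
    rw [map_zero] at h3
    rw [LinearMap.mem_ker, Submodule.mem_comap, mem_conormal_iff, Fintype.linearCombination_apply,
      ← (hfr _ h2).2]
    exact h3.trans ⟨fun h => ⟨sum_smul_mem_span _ c, h⟩, fun h => h.2⟩
  have hkerz := eventually_chart (P := fun _ z =>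
    finrank ℝ (LinearMap.ker (G z).toLinearMap) = r) hker
  obtain ⟨c₀, hc₀⟩ := hsol.self_of_nhds
  obtain ⟨c, hc, -, hGc⟩ := exists_smooth_solution hG
    (b := fun z => (0, chartSec ε x₀ z))
    ((eventually_smoothAt_iff.1 hε).mono fun z hz => contDiffAt_const.prodMk hz)
    (hkerz.mono fun z hz => hz.trans hkerz.self_of_nhds.symm)
    (eventually_chart (P := fun _ z => ∃ d, G z d = (0, chartSec ε x₀ z)) hsol) hc₀
  refine ⟨c, hc, ?_⟩
  filter_upwards [hrel, eventually_extChartAt hGc, eventually_mem_chart_source (n := s) x₀] with x h1 h2 h3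
  rw [chartSec_apply ε h3] at h2
  exact (h1 _ _).1 h2

/-- Only tangency to `S` is imposed here, a homogeneous equation whose solution space is `hat`. A
smooth solution through a lift of `q` is then restricted to `S`. -/
theorem exists_local_section (hV : IsOpen V) (hx₀ : j x₀ ∈ V) (he : ∀ i, SmoothOn (e i) V)
    (hfr : ∀ y ∈ V, LinearIndependent ℝ (fun i => e i y) ∧
      Submodule.span ℝ (Set.range fun i => e i y) = L y)
    {r : ℕ} (hrank : ∀ x, finrank ℝ (hat (L (j x)) (mfderiv (𝓡 s) (𝓡 n) j x)) = r)
    {q : Fib s x₀} (hq : q ∈ induced L hj x₀) :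
    ∃ ε : ∀ x : S, Fib s x, (∀ᶠ x in 𝓝 x₀, SmoothAt ε x) ∧
      (∀ᶠ x in 𝓝 x₀, ε x ∈ induced L hj x) ∧ ε x₀ = q := by
  have hx := mem_chart_source (EuclideanSpace ℝ (Fin s)) x₀
  have hVy : ∀ᶠ y in 𝓝 (j x₀), y ∈ V := hV.mem_nhds hx₀
  have hVx : ∀ᶠ x in 𝓝 x₀, j x ∈ V := hj.contMDiff.continuous.continuousAt.eventually hVy
  obtain ⟨G, hG, hrel⟩ := exists_chart_equation hj.contMDiff
    (mfderiv_injective_of_isImmersion hj x₀) (e := e)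
    fun i => hVy.mono fun y hy => (he i).smoothAt hV hy
  let A : EuclideanSpace ℝ (Fin s) → (Fin k → ℝ) →L[ℝ] EuclideanSpace ℝ (Fin n) :=
    fun z => (ContinuousLinearMap.fst ℝ _ _).comp (G z)
  have hA : ∀ᶠ z in 𝓝 (extChartAt (𝓡 s) x₀ x₀), ContDiffAt ℝ ∞ A z :=
    hG.mono fun z hz => contDiffAt_const.clm_comp hz
  have hAG : ∀ z c, A z c = (G z c).1 := fun z c => rfl
  have hArel : ∀ᶠ x in 𝓝 x₀, ∀ c, A (extChartAt (𝓡 s) x₀ x) c = 0 →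
      Rel (mfderiv (𝓡 s) (𝓡 n) j x) (∑ i, c i • e i (j x))
        (ofCoord x₀ x (G (extChartAt (𝓡 s) x₀ x) c).2) := by
    filter_upwards [hrel, eventually_mem_chart_source (n := s) x₀] with x h1 h2 c hc
    refine (h1 c _).1 ?_
    rw [coord_ofCoord h2]
    exact Prod.ext hc rfl
  have hker : ∀ᶠ x in 𝓝 x₀,
      finrank ℝ (LinearMap.ker (A (extChartAt (𝓡 s) x₀ x)).toLinearMap) = r := by
    filter_upwards [hrel, hArel, hVx] with x h1 h1' h2
    rw [← hrank x, ← finrank_comap_linearCombination (hfr _ h2).1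
      (by rw [(hfr _ h2).2]; exact inf_le_left)]
    refine congrArg (fun K : Submodule ℝ (Fin k → ℝ) => finrank ℝ K) (Submodule.ext fun c => ?_)
    rw [LinearMap.mem_ker, Submodule.mem_comap, mem_hat_iff, Fintype.linearCombination_apply,
      ← (hfr _ h2).2]
    constructor
    · exact fun h => ⟨sum_smul_mem_span _ c, _, h1' c h⟩
    · rintro ⟨-, q, hq⟩
      exact congrArg Prod.fst ((h1 c q).2 hq)
  have hkerz := eventually_chart (P := fun _ z =>
    finrank ℝ (LinearMap.ker (A z).toLinearMap) = r) hker
  obtain ⟨a, ha, hrelq⟩ := (mem_induced_iff_rel hj).1 hq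
  rw [← (hfr _ hx₀).2, Submodule.mem_span_range_iff_exists_fun] at ha
  obtain ⟨c₀, rfl⟩ := ha
  have hc₀ := (hrel.self_of_nhds c₀ q).2 hrelq
  obtain ⟨c, hc, hcp, hGc⟩ := exists_smooth_solution hA (b := fun _ => 0) (c₀ := c₀)
    (Filter.Eventually.of_forall fun z => contDiffAt_const)
    (hkerz.mono fun z hz => hz.trans hkerz.self_of_nhds.symm)
    (Filter.Eventually.of_forall fun z => ⟨0, map_zero _⟩) (congrArg Prod.fst hc₀)
  refine ⟨fun x => ofCoord x₀ x (G (extChartAt (𝓡 s) x₀ x) (c (extChartAt (𝓡 s) x₀ x))).2,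
    ?_, ?_, ?_⟩
  · rw [eventually_smoothAt_iff]
    have h1 : ∀ᶠ z in 𝓝 (extChartAt (𝓡 s) x₀ x₀), chartSec (fun x => ofCoord x₀ x
        (G (extChartAt (𝓡 s) x₀ x) (c (extChartAt (𝓡 s) x₀ x))).2) x₀ z = (G z (c z)).2 := by
      filter_upwards [extChartAt_target_mem_nhds (I := 𝓡 s) x₀] with z hz
      rw [chartSec, coord_ofCoord (symm_mem_source hz), (extChartAt (𝓡 s) x₀).right_inv hz]
    filter_upwards [h1.eventually_nhds, hG, hc] with z h2 h3 h4
    exact (h3.clm_apply h4).snd.congr_of_eventuallyEq h2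
  · filter_upwards [hArel, hVx, eventually_extChartAt hGc] with x h1 h2 h3
    refine (mem_induced_iff_rel hj).2 ⟨_, ?_, h1 _ h3⟩
    rw [← (hfr _ h2).2]
    exact sum_smul_mem_span _ _
  · change ofCoord x₀ x₀ _ = q
    rw [hcp, hc₀, ofCoord_coord hx]

end Induced

/-! ### The bundle `L_S` and extension of its sections -/

section InducedDirac

open Module

variable {n s : ℕ}
  {M : Type*} [TopologicalSpace M] [ChartedSpace (EuclideanSpace ℝ (Fin n)) M]
  [IsManifold (𝓡 n) ∞ M]
  {S : Type*} [TopologicalSpace S] [ChartedSpace (EuclideanSpace ℝ (Fin s)) S]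
  [IsManifold (𝓡 s) ∞ S] {L : ∀ y : M, Submodule ℝ (Fib n y)} {j : S → M}
  (hj : Manifold.IsImmersion (𝓡 s) (𝓡 n) ∞ j)

theorem eventually_linearIndependent {k : ℕ} {ε : Fin k → ∀ x : S, Fib s x} {x₀ : S}
    (hε : ∀ i, SmoothAt (ε i) x₀) (hli : LinearIndependent ℝ fun i => ε i x₀) :
    ∀ᶠ x in 𝓝 x₀, LinearIndependent ℝ fun i => ε i x := by
  have hp : LinearIndependent ℝ fun i => coord x₀ x₀ (ε i x₀) :=
    hli.map' _ (LinearMap.ker_eq_bot.2 (coord_injective (mem_chart_source _ x₀)))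
  have hc : ContinuousAt (fun z i => chartSec (ε i) x₀ z) (extChartAt (𝓡 s) x₀ x₀) :=
    continuousAt_pi.2 fun i => ((smoothAt_iff (mem_chart_source _ x₀)).1 (hε i)).continuousAt
  have hp' : LinearIndependent ℝ fun i => chartSec (ε i) x₀ (extChartAt (𝓡 s) x₀ x₀) := by
    have h1 : (fun i => chartSec (ε i) x₀ (extChartAt (𝓡 s) x₀ x₀)) =
        fun i => coord x₀ x₀ (ε i x₀) :=
      funext fun i => chartSec_apply _ (mem_chart_source _ x₀)
    rw [h1]
    exact hp
  have h2 := hc.eventually (isOpen_setOfPred_linearIndependent.mem_nhds hp')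
  filter_upwards [eventually_extChartAt h2, eventually_mem_chart_source (n := s) x₀] with x h3 h4
  have h5 : (fun i => chartSec (ε i) x₀ (extChartAt (𝓡 s) x₀ x)) =
      fun i => coord x₀ x (ε i x) := funext fun i => chartSec_apply _ h4
  have h6 : LinearIndependent ℝ fun i => chartSec (ε i) x₀ (extChartAt (𝓡 s) x₀ x) := h3
  rw [h5] at h6
  exact LinearIndependent.of_comp (coord x₀ x) h6

theorem exists_linearIndependent_mem {V : Type*} [AddCommGroup V] [Module ℝ V]
    [FiniteDimensional ℝ V] {N : Submodule ℝ V} {m : ℕ} (h : finrank ℝ N = m) :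
    ∃ v : Fin m → V, (∀ i, v i ∈ N) ∧ LinearIndependent ℝ v :=
  ⟨fun i => finBasisOfFinrankEq ℝ N h i, fun i => (finBasisOfFinrankEq ℝ N h i).2,
    (finBasisOfFinrankEq ℝ N h).linearIndependent.map' N.subtype N.ker_subtype⟩

theorem isLagrangian_induced {x : S} (hL : IsLagrangian (L (j x))) :
    IsLagrangian (induced L hj x) := by
  rw [induced, quotientMap, Submodule.range_liftQ]
  exact hL.range_restrict _

/-- Local sections through a basis of one fibre remain independent nearby, and they span because
every fibre of `L_S` is Lagrangian, hence of dimension `s + 1`. -/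
theorem isSubbundle_induced (hL : IsSubbundle L) (hlag : ∀ y, IsLagrangian (L y)) {r : ℕ}
    (hrank : ∀ x, finrank ℝ (hat (L (j x)) (mfderiv (𝓡 s) (𝓡 n) j x)) = r) :
    IsSubbundle (induced L hj) := by
  obtain ⟨k, hk⟩ := hL
  refine ⟨s + 1, fun x₀ => ?_⟩
  obtain ⟨V, hV, hx₀, e, he, hfr⟩ := hk (j x₀)
  have hfin : ∀ x, finrank ℝ (induced L hj x) = s + 1 := fun x =>
    (isLagrangian_induced hj (hlag _)).finrank_eq
  obtain ⟨b, hbN, hb⟩ := exists_linearIndependent_mem (hfin x₀)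
  choose ε hε hmem hεb using fun i =>
    exists_local_section hj hV hx₀ he hfr hrank (hbN i)
  have hli₀ : LinearIndependent ℝ fun i => ε i x₀ := by
    rwa [show (fun i => ε i x₀) = b from funext hεb]
  have hli := eventually_linearIndependent (fun i => (hε i).self_of_nhds) hli₀
  have hall := hli.and ((Filter.eventually_all.2 hε).and (Filter.eventually_all.2 hmem))
  obtain ⟨U, hU, hUo, hxU⟩ := eventually_nhds_iff.1 hall
  refine ⟨U, hUo, hxU, ε, fun i => smoothOn_of_smoothAt fun x hx => (hU x hx).2.1 i,
    fun x hx => ⟨(hU x hx).1, ?_⟩⟩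
  refine Submodule.eq_of_le_of_finrank_eq ?_ ?_
  · rw [Submodule.span_le]
    rintro _ ⟨i, rfl⟩
    exact (hU x hx).2.2 i
  · rw [finrank_span_eq_card (hU x hx).1, hfin, Fintype.card_fin]

/-- Relatedness is obtained only near `x₀`, which suffices because the value of the bracket at a
point depends only on germs there. -/
theorem exists_related_extension [T2Space M] (hL : IsSubbundle L) {r : ℕ}
    (hrank : ∀ x, finrank ℝ (conormal (L (j x)) (mfderiv (𝓡 s) (𝓡 n) j x)) = r)
    {ε : ∀ x : S, Fib s x} (hε : SmoothOn ε Set.univ) (hmem : ∀ x, ε x ∈ induced L hj x) (x₀ : S) :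
    ∃ e : ∀ y : M, Fib n y, SmoothOn e Set.univ ∧ (∀ y, e y ∈ L y) ∧
      ∀ᶠ x in 𝓝 x₀, Rel (mfderiv (𝓡 s) (𝓡 n) j x) (e (j x)) (ε x) := by
  obtain ⟨k, hk⟩ := hL
  obtain ⟨V, hV, hx₀, e, he, hfr⟩ := hk (j x₀)
  obtain ⟨c, hc, hrel⟩ := exists_smooth_lift hj hV hx₀ he hfr hrank
    (Filter.Eventually.of_forall fun x => hε.smoothAt isOpen_univ (Set.mem_univ x))
    (Filter.Eventually.of_forall hmem)
  obtain ⟨ρ, hρ, hρj⟩ := exists_chart_retraction hj.contMDiff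
    (mfderiv_injective_of_isImmersion hj x₀)
  have hx := mem_chart_source (EuclideanSpace ℝ (Fin s)) x₀
  have hVy : ∀ᶠ y in 𝓝 (j x₀), y ∈ V := hV.mem_nhds hx₀
  have hJp : chartMap n s j x₀ (extChartAt (𝓡 s) x₀ x₀) = extChartAt (𝓡 n) (j x₀) (j x₀) :=
    chartMap_apply hx
  have hρp := hρj.self_of_nhds
  rw [hJp] at hρ hρp
  -- The coefficients, defined along `S`, are made constant along the fibres of the retraction `ρ`;
  -- since `ρ` inverts the immersion in charts, the lift along `S` is recovered.
  let e₀ : ∀ y : M, Fib n y := fun y => ∑ i, c (ρ (extChartAt (𝓡 n) (j x₀) y)) i • e i y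
  have hsm : ∀ᶠ y in 𝓝 (j x₀), SmoothAt e₀ y := by
    rw [eventually_smoothAt_iff]
    have h1 : ∀ᶠ y in 𝓝 (extChartAt (𝓡 n) (j x₀) (j x₀)), chartSec e₀ (j x₀) y =
        ∑ i, c (ρ y) i • chartSec (e i) (j x₀) y := by
      filter_upwards [extChartAt_target_mem_nhds (I := 𝓡 n) (j x₀)] with y hy
      rw [chartSec, map_sum, (extChartAt (𝓡 n) (j x₀)).right_inv hy]
      exact Finset.sum_congr rfl fun i _ => map_smul (coord (j x₀) _) _ _
    have h2 : ∀ᶠ y in 𝓝 (extChartAt (𝓡 n) (j x₀) (j x₀)), ∀ i,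
        ContDiffAt ℝ ∞ (chartSec (e i) (j x₀)) y :=
      Filter.eventually_all.2 fun i => eventually_smoothAt_iff.1
        (hVy.mono fun y hy => (he i).smoothAt hV hy)
    have h3 : ∀ᶠ y in 𝓝 (extChartAt (𝓡 n) (j x₀) (j x₀)), ContDiffAt ℝ ∞ c (ρ y) := by
      refine hρ.self_of_nhds.continuousAt.eventually ?_
      rwa [hρp]
    filter_upwards [h1.eventually_nhds, h2, h3, hρ] with y k1 k2 k3 k4
    refine ContDiffAt.congr_of_eventuallyEq (ContDiffAt.sum fun i _ => ?_) k1
    exact ((contDiffAt_pi.1 k3 i).comp y k4).smul (k2 i)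
  have hmemL : ∀ᶠ y in 𝓝 (j x₀), e₀ y ∈ L y := by
    filter_upwards [hVy] with y hy
    rw [← (hfr y hy).2]
    exact sum_smul_mem_span _ _
  obtain ⟨e', he', hL', heq⟩ := exists_global_extension hsm hmemL
  refine ⟨e', he', hL', ?_⟩
  filter_upwards [hrel, hj.contMDiff.continuous.continuousAt.eventually heq,
    eventually_extChartAt hρj, eventually_mem_chart_source (n := s) x₀] with x h1 h2 h3 h4
  rw [chartMap_apply h4] at h3
  rw [h2]
  change Rel _ (∑ i, c (ρ (extChartAt (𝓡 n) (j x₀) (j x))) i • e i (j x)) _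
  rw [h3]
  exact h1

end InducedDirac

end E1Dirac

end

/-! ### The induced Dirac structure -/

theorem proposition4p1 {n s : ℕ}
    {M : Type*} [TopologicalSpace M] [ChartedSpace (EuclideanSpace ℝ (Fin n)) M]
    [IsManifold (𝓡 n) ∞ M] [T2Space M] [SecondCountableTopology M] [ConnectedSpace M]
    {S : Type*} [TopologicalSpace S] [ChartedSpace (EuclideanSpace ℝ (Fin s)) S]
    [IsManifold (𝓡 s) ∞ S] [T2Space S] [SecondCountableTopology S] [ConnectedSpace S]
    (L : ∀ y : M, Submodule ℝ (E1Dirac.Fib n y)) (hL : E1Dirac.IsDirac L)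
    (j : S → M) (hj : Manifold.IsImmersion (𝓡 s) (𝓡 n) ∞ j) (hinj : Function.Injective j) :
    ((∃ k : ℕ, ∀ x : S,
        Module.finrank ℝ (E1Dirac.hat (L (j x)) (mfderiv (𝓡 s) (𝓡 n) j x)) = k) ↔
      ∃ k : ℕ, ∀ x : S,
        Module.finrank ℝ (E1Dirac.conormal (L (j x)) (mfderiv (𝓡 s) (𝓡 n) j x)) = k) ∧
    ((∃ k : ℕ, ∀ x : S,
        Module.finrank ℝ (E1Dirac.hat (L (j x)) (mfderiv (𝓡 s) (𝓡 n) j x)) = k) →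
      E1Dirac.IsSubbundle (E1Dirac.induced L hj) ∧ E1Dirac.IsDirac (E1Dirac.induced L hj)) := by
  have hlag : ∀ y, E1Dirac.IsLagrangian (L y) := fun y =>
    E1Dirac.isLagrangian_of_maximal (hL.maximal_isotropic y)
  have hdim : ∀ x, Module.finrank ℝ (E1Dirac.hat (L (j x)) (mfderiv (𝓡 s) (𝓡 n) j x)) =
      s + 1 + Module.finrank ℝ (E1Dirac.conormal (L (j x)) (mfderiv (𝓡 s) (𝓡 n) j x)) := fun x =>
    (hlag (j x)).finrank_hat (E1Dirac.mfderiv_injective_of_isImmersion hj x)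
  have hiff : (∃ k : ℕ, ∀ x : S,
        Module.finrank ℝ (E1Dirac.hat (L (j x)) (mfderiv (𝓡 s) (𝓡 n) j x)) = k) ↔
      ∃ k : ℕ, ∀ x : S,
        Module.finrank ℝ (E1Dirac.conormal (L (j x)) (mfderiv (𝓡 s) (𝓡 n) j x)) = k := by
    constructor
    · rintro ⟨k, hk⟩
      -- The subtraction is not truncated as soon as `S` has a point, by `hdim`.
      refine ⟨k - (s + 1), fun x => ?_⟩
      have h1 := hdim x
      rw [hk x] at h1
      omega
    · rintro ⟨k, hk⟩
      exact ⟨s + 1 + k, fun x => by rw [hdim x, hk x]⟩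
  refine ⟨hiff, fun hhat => ?_⟩
  obtain ⟨r, hr⟩ := hiff.1 hhat
  obtain ⟨k, hk⟩ := hhat
  have hsub := E1Dirac.isSubbundle_induced hj hL.isSubbundle hlag hk
  refine ⟨hsub, hsub, fun x => (E1Dirac.isLagrangian_induced hj (hlag _)).maximal, ?_⟩
  intro ε₁ ε₂ hε₁ hmem₁ hε₂ hmem₂ x
  obtain ⟨e₁, he₁, hL₁, hrel₁⟩ :=
    E1Dirac.exists_related_extension hj hL.isSubbundle hr hε₁ hmem₁ x
  obtain ⟨e₂, he₂, hL₂, hrel₂⟩ :=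
    E1Dirac.exists_related_extension hj hL.isSubbundle hr hε₂ hmem₂ x
  refine (E1Dirac.mem_induced_iff_rel hj).2
    ⟨_, hL.bracket_mem e₁ e₂ he₁ hL₁ he₂ hL₂ (j x), ?_⟩
  exact E1Dirac.rel_bracket hj.contMDiff (he₁.smoothAt isOpen_univ trivial)
    (he₂.smoothAt isOpen_univ trivial) (hε₁.smoothAt isOpen_univ trivial)
    (hε₂.smoothAt isOpen_univ trivial) hrel₁ hrel₂
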